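/- **Setting.** Let $M^n$ be a smooth manifold without boundary (Hausdorff, second countable), $U$ a set, and $V_u$ ($u\in U$) smooth complete vector fields on $M$, with flows $P_u^t$. Fix a class $\mathcal A$ of admissible controls $u:\mathbb R\to U$: it contains the constants, is closed under time shifts and under switching from one control to another at some moment, and for every $u\in\mathcal A$ the nonautonomous field $V_{u(t)}$ is measurable in $t$ and, on every compact subset of a chart, bounded together with its first space derivatives by a locally integrable function of $t$. (Example: piecewise constant controls.) A trajectory on $[0,T]$ is an absolutely continuous curve with $\dot q(t)=V_{u(t)}(q(t))$ for almost every $t$, for some $u\in\mathcal A$; $\mathcal O^+(q)$ is the set of end points of trajectories that start at $q$. Let $V_{u_1},\dots,V_{u_d}$ be finitely many of the control fields and $B$ a finite set of multi-indices in $\{1,\dots,d\}$ that contains $(1),\dots,(d)$. Each $\beta=(\beta_1,\dots,\beta_k)\in B$ gives the iterated bracket $W_\beta=[V_{u_{\beta_1}},[V_{u_{\beta_2}},[\dots,V_{u_{\beta_k}}]]]$, with $W_{(i)}=V_{u_i}$. Expanding this commutator gives the words $\beta_{\sigma(1)}\cdots\beta_{\sigma(k)}$, called its monomials (e.g. $[a,[b,c]]$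 has $abc,acb,bca,cba$). A word $w=w_1\cdots w_N$ in $\{1,\dots,d\}$ is *general* if it is a concatenation, in any order and possibly with repetitions, of monomials of the $\beta\in B$ in which every monomial of every $\beta\in B$ is used. For such a word put $q_w(t_1,\dots,t_N)=P^{t_1}_{u_{w_1}}\circ\cdots\circ P^{t_N}_{u_{w_N}}(q)$ and let $\Omega_w\subset\mathbb R^N$ be the set of $t$ at which the differential of $q_w$ is not onto. A trajectory $q(t)$, $0\le t\le T$, with $q(0)=q$ is *general* relative to $B$ if for some $0<\varepsilon\le T$ one has $q(\varepsilon)=q_w(t_1,\dots,t_N)$ with $w$ general, all $t_i>0$ and $t\notin\Omega_w$. **Theorem 1.** Suppose that LARC holds at $q$, with this set of generators: the vectors $W_\beta(q)$, $\beta\in B$, span $T_qM$. Then 1. for every general word $w$ the set $\{q_w(t): \text{all } t_i>0,\ t\notin\Omega_w\}$ is open in $M$; the union of these sets over all general words, that is, the set of points $q_w(t_1,\dots,t_N)$ with positive $t_i$ reachable from $q$ by general trajectories relative to this set of generators, is open and non-empty; 2. if $q(t)$, $0\le t\le t_q$, $q(0)=q(t_q)=q$, is a closed trajectory through $q$ that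 is general relative to this set of generators, then there is an open set $B_q^+$ that contains $\{q(t):0\le t\le t_q\}$ and satisfies $B_q^+\subset\mathcal O^+(q)$. -/

import Mathlib

open Set MeasureTheory
open scoped Manifold ContDiff

namespace ControlSystem

section Fields

variable {n : ℕ} {M : Type*} [TopologicalSpace M] [ChartedSpace (EuclideanSpace ℝ (Fin n)) M]

/-- A vector field is smooth if it is a smooth section of the tangent bundle. -/
def IsSmoothField [IsManifold (𝓡 n) ∞ M] (X : (x : M) → TangentSpace (𝓡 n) x) : Prop :=
  ContMDiff (𝓡 n) (𝓡 n).tangent ∞ (fun x => (⟨x, X x⟩ : TangentBundle (𝓡 n) M))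

/-- A vector field is complete if through every point there is an integral curve defined for all
times. -/
def IsCompleteField (X : (x : M) → TangentSpace (𝓡 n) x) : Prop :=
  ∀ x : M, ∃ γ : ℝ → M, γ 0 = x ∧ IsMIntegralCurve γ X

open Classical in
/-- The flow `P^t` of a complete vector field: `flow X t x` is the value at time `t` of the integral
curve of `X` that starts at `x` (unique for a smooth field on a Hausdorff manifold). -/
noncomputable def flow (X : (x : M) → TangentSpace (𝓡 n) x) (t : ℝ) (x : M) : M :=
  if h : ∃ γ : ℝ → M, γ 0 = x ∧ IsMIntegralCurve γ X then h.choose t else x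

/-- The chronological product `P^{t₁}_{w₁} ∘ ⋯ ∘ P^{t_N}_{w_N}` along a word `w = w₁ ⋯ w_N` in the
indices of the fields `W i`. -/
noncomputable def chronProduct {ι : Type*} (W : ι → (x : M) → TangentSpace (𝓡 n) x) :
    (w : List ι) → (Fin w.length → ℝ) → M → M
  | [], _, q => q
  | a :: w, t, q => flow (W a) (t 0) (chronProduct W w (Fin.tail t) q)

/-- The iterated bracket `[W_{β₁}, [W_{β₂}, [⋯, W_{β_k}]]]` of a multi-index `β`; for `k = 1` it is
the field `W_{β₁}` itself. -/
noncomputable def iterBracket {ι : Type*} (W : ι → (x : M) → TangentSpace (𝓡 n) x) :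
    List ι → (x : M) → TangentSpace (𝓡 n) x
  | [] => fun _ => 0
  | [a] => W a
  | a :: b :: l => VectorField.mlieBracket (𝓡 n) (W a) (iterBracket W (b :: l))

/-- The multi-indices in `B`, among which are all the one-letter ones, give a set of generators at
`q`: the fields `W i` and their iterated brackets listed in `B` span the tangent space at `q`. -/
def IsGeneratingAt {ι : Type*} (W : ι → (x : M) → TangentSpace (𝓡 n) x) (B : Finset (List ι))
    (q : M) : Prop :=
  (∀ i, [i] ∈ B) ∧
    Submodule.span ℝ {v : TangentSpace (𝓡 n) q | ∃ β ∈ B, v = iterBracket W β q} = ⊤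

/-- The words that occur when the iterated commutator of the multi-index `β` is expanded into
compositions of its letters, as in `[a, [b, c]] = abc - acb - bca + cba`. -/
def bracketMonomials {ι : Type*} : List ι → List (List ι)
  | [] => []
  | [a] => [[a]]
  | a :: b :: l => (bracketMonomials (b :: l)).flatMap (fun m => [a :: m, m ++ [a]])

/-- A word is general relative to the set of generators `B` if it is put together, in any order,
from the words in the expansions of the brackets in `B`, and each of these words is used. -/
def IsGeneralWord {ι : Type*} (B : Finset (List ι)) (w : List ι) : Prop :=
  ∃ L : List (List ι), w = L.flatten ∧
    (∀ m ∈ L, ∃ β ∈ B, m ∈ bracketMonomials β) ∧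
    ∀ β ∈ B, ∀ m ∈ bracketMonomials β, m ∈ L

/-- The zero set `Ω` of the chronological product along `w` at `q`: the parameters at which the
differential of `t ↦ (P^{t₁} ∘ ⋯ ∘ P^{t_N}) q` is not onto. -/
def zeroSet {ι : Type*} (W : ι → (x : M) → TangentSpace (𝓡 n) x) (w : List ι) (q : M) :
    Set (Fin w.length → ℝ) :=
  {t | ¬ Function.Surjective (mfderiv 𝓘(ℝ, Fin w.length → ℝ) (𝓡 n)
    (fun s : Fin w.length → ℝ => chronProduct W w s q) t)}

/-- The points `q(t₁, …, t_N)` with all `t_i` positive and `t ∉ Ω`, for one word `w`. -/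
def regularPoints {ι : Type*} (W : ι → (x : M) → TangentSpace (𝓡 n) x) (w : List ι) (q : M) :
    Set M :=
  {p | ∃ t : Fin w.length → ℝ, (∀ i, 0 < t i) ∧ t ∉ zeroSet W w q ∧ chronProduct W w t q = p}

/-- The points `q(t₁, …, t_N)`, all `t_i` positive, reachable from `q` by general trajectories
relative to the set of generators `B`. -/
def generalPoints {ι : Type*} (W : ι → (x : M) → TangentSpace (𝓡 n) x) (B : Finset (List ι))
    (q : M) : Set M :=
  {p | ∃ w : List ι, IsGeneralWord B w ∧ p ∈ regularPoints W w q}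

/-- The coordinate expression of a vector field in the chart around `x₀`. -/
noncomputable def coordField (X : (x : M) → TangentSpace (𝓡 n) x) (x₀ : M)
    (y : EuclideanSpace ℝ (Fin n)) : EuclideanSpace ℝ (Fin n) :=
  mfderiv (𝓡 n) 𝓘(ℝ, EuclideanSpace ℝ (Fin n)) (extChartAt (𝓡 n) x₀)
    ((extChartAt (𝓡 n) x₀).symm y) (X ((extChartAt (𝓡 n) x₀).symm y))

/-- A nonautonomous vector field that is measurable in time and, on compact subsets of charts,
bounded together with its first space derivatives by a locally integrable function of time. -/
def IsLocallyIntegrableField (X : ℝ → (x : M) → TangentSpace (𝓡 n) x) : Prop :=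
  ∀ x₀ : M,
    (∀ y ∈ (extChartAt (𝓡 n) x₀).target,
      AEStronglyMeasurable (fun t => coordField (X t) x₀ y) volume) ∧
    ∀ K ⊆ (extChartAt (𝓡 n) x₀).target, IsCompact K →
      ∃ m : ℝ → ℝ, LocallyIntegrable m volume ∧ ∀ᵐ t : ℝ, ∀ y ∈ K,
        ‖coordField (X t) x₀ y‖ ≤ m t ∧ ‖fderiv ℝ (coordField (X t) x₀) y‖ ≤ m t

variable {U : Type*}

/-- A class of admissible controls for the system `q̇ = V_u(q)`. It contains the constant controls
and is closed under time shifts and under switching from one control to another, and every control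
in it gives a locally integrable nonautonomous field. The piecewise constant controls form such
a class; so do the locally integrable controls of a control-affine system. -/
structure IsAdmissibleClass (V : U → (x : M) → TangentSpace (𝓡 n) x) (A : Set (ℝ → U)) : Prop where
  const_mem : ∀ a : U, (fun _ => a) ∈ A
  shift_mem : ∀ u ∈ A, ∀ s : ℝ, (fun t => u (t + s)) ∈ A
  switch_mem : ∀ u ∈ A, ∀ v ∈ A, ∀ s : ℝ, (fun t => if t < s then u t else v t) ∈ A
  locallyIntegrable : ∀ u ∈ A, IsLocallyIntegrableField (fun t => V (u t))

/-- `γ` is, on `[0, T]`, a trajectory of the system under the control `u`: an absolutely continuous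
curve with `γ̇(t) = V_{u(t)}(γ(t))` for almost every `t`. -/
structure IsTrajectory (V : U → (x : M) → TangentSpace (𝓡 n) x) (u : ℝ → U) (γ : ℝ → M) (T : ℝ) :
    Prop where
  continuousOn : ContinuousOn γ (Icc 0 T)
  absolutelyContinuous : ∀ (x₀ : M) (a b : ℝ), 0 ≤ a → a ≤ b → b ≤ T →
    (∀ t ∈ Icc a b, γ t ∈ (extChartAt (𝓡 n) x₀).source) →
    AbsolutelyContinuousOnInterval (fun t => extChartAt (𝓡 n) x₀ (γ t)) a b
  hasMFDerivAt : ∀ᵐ t : ℝ, t ∈ Icc 0 T →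
    HasMFDerivAt 𝓘(ℝ, ℝ) (𝓡 n) γ t ((1 : ℝ →L[ℝ] ℝ).smulRight (V (u t) (γ t)))

/-- The positive orbit `O⁺(q)`: the points reachable from `q` by trajectories with controls in
`A`. -/
def positiveOrbit (V : U → (x : M) → TangentSpace (𝓡 n) x) (A : Set (ℝ → U)) (q : M) : Set M :=
  {p | ∃ u ∈ A, ∃ (γ : ℝ → M) (T : ℝ), 0 ≤ T ∧ IsTrajectory V u γ T ∧ γ 0 = q ∧ γ T = p}

/-- The curve `γ` on `[0, T]`, starting at `q`, is general relative to the set of generators `B`: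
an initial interval of it ends at a point `q(t₁, …, t_N)` of a general chronological product with
all `t_i` positive and `t ∉ Ω`. -/
def IsGeneralCurve {ι : Type*} (W : ι → (x : M) → TangentSpace (𝓡 n) x) (B : Finset (List ι))
    (q : M) (γ : ℝ → M) (T : ℝ) : Prop :=
  γ 0 = q ∧ ∃ ε : ℝ, 0 < ε ∧ ε ≤ T ∧ γ ε ∈ generalPoints W B q

end Fields

end ControlSystem

/-!
Openness of the set of general points is the submersion theorem: the flow of a smooth complete field
is `C²` jointly in time and initial point (`contMDiff_flow`), hence so is every chronological
product, and a `C²` map is open near the points at which its differential is onto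
(`isOpen_image_surjective`). Mathlib has no smooth dependence of solutions on initial points; here
it comes from the implicit function theorem for the rescaled integral equation in a space of
continuous curves (`exists_contDiffAt_solution`).

Non-emptiness is Krener's argument (`IsGeneratingAt.exists_regularPoints_nonempty`). Among all
chronological products with positive times that end near `q`, take one whose differential has
maximal rank `k`. No field can be transversal to its image, since flowing along that field for a
short positive time would raise the rank (`exists_pos_finrank_lt`). So all fields are tangent to a
`k`-dimensional immersed piece, and so are their iterated brackets (`lieBracket_mem_range_fderiv`);
these span, so that `k = n`. Flow maps are diffeomorphisms, and therefore a word remains regular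
when all the monomials of the brackets are put in front of it, which makes it general.

For the closed trajectory, let `N` be the interior of the positive orbit of `q`. It contains the
general points, as these form an open set of reachable points. The key fact is that a trajectory
that has entered `N` does not leave it (`IsTrajectory.mem_interior_of_le`): if `γ s₁` is in `N` and
`s₂` is a little later, solve the Carathéodory equation backward from an arbitrary point `p` near
`γ s₂`, with the same control. The solution is near `γ s₁` at time `s₁`
(`IsCaratheodory.exists_solution_near`), hence reachable from `q`, and it leads forward to `p`. A
general closed trajectory is in `N` at some time `ε`, hence at its end; the end is also its
beginning, so that it lies in `N` at all times.
-/

namespace ControlSystem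

open Filter Topology

universe u

/-! ### Superposition operators on spaces of continuous curves -/

section Nemytskii

variable {K : Type*} [TopologicalSpace K] [CompactSpace K]
  {E F : Type*} [NormedAddCommGroup E] [NormedSpace ℝ E] [NormedAddCommGroup F] [NormedSpace ℝ F]

/-- The pointwise application `(A, β) ↦ (t ↦ A t (β t))` as a bounded bilinear map. -/
noncomputable def pointwiseApply (K : Type*) [TopologicalSpace K] [CompactSpace K]
    (E F : Type*) [NormedAddCommGroup E] [NormedSpace ℝ E] [NormedAddCommGroup F]
    [NormedSpace ℝ F] : C(K, E →L[ℝ] F) →L[ℝ] C(K, E) →L[ℝ] C(K, F) :=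
  LinearMap.mkContinuous₂
    (LinearMap.mk₂ ℝ (fun (A : C(K, E →L[ℝ] F)) (β : C(K, E)) =>
      (⟨fun t => A t (β t), A.continuous.clm_apply β.continuous⟩ : C(K, F)))
      (fun _ _ _ => by ext; simp) (fun _ _ _ => by ext; simp)
      (fun _ _ _ => by ext; simp) (fun _ _ _ => by ext; simp)) 1 (by
    intro A β
    rw [ContinuousMap.norm_le _ (by positivity)]
    intro t
    rw [one_mul]
    exact (A t).le_of_opNorm_le_of_le (A.norm_coe_le_norm t) (β.norm_coe_le_norm t))

@[simp] lemma pointwiseApply_apply (A : C(K, E →L[ℝ] F)) (β : C(K, E)) (t : K) :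
    pointwiseApply K E F A β t = A t (β t) := rfl

/-- Compact support makes the derivative of `f` uniformly continuous, which is what makes
composition with `f` differentiable for the norm of uniform convergence. -/
lemma hasFDerivAt_postcomp {f : E → F} (hf : ContDiff ℝ 1 f) (hc : HasCompactSupport f)
    (α : C(K, E)) :
    HasFDerivAt (fun β : C(K, E) => (⟨f, hf.continuous⟩ : C(E, F)).comp β)
      (pointwiseApply K E F
        ((⟨fderiv ℝ f, hf.continuous_fderiv one_ne_zero⟩ : C(E, E →L[ℝ] F)).comp α)) α := by
  rw [hasFDerivAt_iff_isLittleO_nhds_zero, Asymptotics.isLittleO_iff]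
  intro ε hε
  have hu : UniformContinuous (fderiv ℝ f) :=
    (hf.continuous_fderiv one_ne_zero).uniformContinuous_of_tendsto_cocompact
      (hc.fderiv (𝕜 := ℝ)).is_zero_at_infty
  obtain ⟨δ, hδ, h⟩ := Metric.uniformContinuous_iff.1 hu ε hε
  filter_upwards [Metric.ball_mem_nhds (0 : C(K, E)) hδ] with β hβ
  rw [ContinuousMap.norm_le _ (by positivity)]
  intro t
  have hβ' : ‖β‖ < δ := by simpa using hβ
  have hβt : ‖β t‖ ≤ ‖β‖ := β.norm_coe_le_norm t
  have key := (convex_ball (α t) δ).norm_image_sub_le_of_norm_fderiv_le' (𝕜 := ℝ) (f := f)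
    (φ := fderiv ℝ f (α t)) (C := ε) (x := α t) (y := α t + β t)
    (fun x _ => (hf.differentiable one_ne_zero) x)
    (fun x hx => by rw [← dist_eq_norm]; exact (h (by simpa using hx)).le)
    (Metric.mem_ball_self hδ) (by simpa using hβt.trans_lt hβ')
  simp only [add_sub_cancel_left] at key
  refine (le_trans ?_ key).trans (by gcongr)
  simp

/-- Composition with a compactly supported `C^k` map is a `C^k` map between spaces of continuous
functions on a compact space. -/
lemma contDiff_postcomp {E : Type u} [NormedAddCommGroup E] [NormedSpace ℝ E] (k : ℕ) :
    ∀ {F : Type u} [NormedAddCommGroup F] [NormedSpace ℝ F]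
    {f : E → F} (hf : ContDiff ℝ k f) (_ : HasCompactSupport f),
    ContDiff ℝ k (fun β : C(K, E) => (⟨f, hf.continuous⟩ : C(E, F)).comp β) := by
  induction k with
  | zero =>
    intro F _ _ f hf hc
    exact contDiff_zero.2 (ContinuousMap.continuous_postcomp _)
  | succ k ih =>
    intro F _ _ f hf hc
    have hf1 : ContDiff ℝ 1 f := hf.of_le (by exact_mod_cast Nat.le_add_left 1 k)
    have h := ih (F := E →L[ℝ] F) (f := fderiv ℝ f)
      (hf.fderiv_right (m := k) (by norm_cast)) (hc.fderiv (𝕜 := ℝ))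
    exact contDiff_succ_iff_hasFDerivAt.2 ⟨fun α => pointwiseApply K E F
        ((⟨fderiv ℝ f, hf1.continuous_fderiv one_ne_zero⟩ : C(E, E →L[ℝ] F)).comp α),
        h.continuousLinearMap_comp (pointwiseApply K E F),
        fun α => hasFDerivAt_postcomp hf1 hc α⟩

end Nemytskii

/-! ### Smooth dependence of solutions on initial points -/

section LocalFlow

variable {E : Type u} [NormedAddCommGroup E]

local notation "J" => Icc (-1 : ℝ) 1

/-- The extension of a continuous curve on `[-1, 1]` by constants. -/
noncomputable def extendCurve (β : C(J, E)) (s : ℝ) : E := β (projIcc (-1) 1 (by norm_num) s)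

lemma continuous_extendCurve (β : C(J, E)) : Continuous (extendCurve β) :=
  β.continuous.comp continuous_projIcc

lemma extendCurve_coe (β : C(J, E)) (t : J) : extendCurve β t = β t := by
  simp [extendCurve]

lemma norm_extendCurve_le (β : C(J, E)) (s : ℝ) : ‖extendCurve β s‖ ≤ ‖β‖ :=
  β.norm_coe_le_norm _

variable [NormedSpace ℝ E]

/-- The primitive vanishing at `0`, as a bounded operator on continuous curves on `[-1, 1]`. -/
noncomputable def primitiveOp (E : Type u) [NormedAddCommGroup E] [NormedSpace ℝ E] :
    C(J, E) →L[ℝ] C(J, E) :=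
  LinearMap.mkContinuous
    { toFun := fun β => ⟨fun t => ∫ s in (0 : ℝ)..t, extendCurve β s,
        (intervalIntegral.continuous_primitive
          (fun a b => (continuous_extendCurve β).intervalIntegrable a b) 0).comp
          continuous_subtype_val⟩
      map_add' := fun α β => by
        ext t
        exact intervalIntegral.integral_add
          ((continuous_extendCurve α).intervalIntegrable _ _)
          ((continuous_extendCurve β).intervalIntegrable _ _)
      map_smul' := fun c β => by
        ext t
        exact intervalIntegral.integral_smul c (extendCurve β) } 1 (by
    intro β
    rw [ContinuousMap.norm_le _ (by positivity)]
    intro t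
    have h := intervalIntegral.norm_integral_le_of_norm_le_const (a := 0) (b := (t : ℝ))
      (f := extendCurve β) (C := ‖β‖) (fun s _ => norm_extendCurve_le β s)
    refine h.trans ?_
    rw [mul_comm, sub_zero]
    exact mul_le_mul_of_nonneg_right (abs_le.2 t.2) (norm_nonneg _))

lemma primitiveOp_apply (β : C(J, E)) (t : J) :
    primitiveOp E β t = ∫ s in (0 : ℝ)..t, extendCurve β s := rfl

/-- A compactly supported `C²` field has, near a point, solutions on `[-1, 1]` of the rescaled
equation `α' = ε X(α)`, `α 0 = x`, that are a `C²` function of `(ε, x)` with values in the space of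
continuous curves. At `ε = 0` the linearization of the integral equation in `α` is the identity, so
that the implicit function theorem applies. -/
lemma exists_contDiffAt_solution [CompleteSpace E] {X : E → E} (hX : ContDiff ℝ 2 X)
    (hc : HasCompactSupport X) (x₀ : E) :
    ∃ Ψ : ℝ × E → C(J, E), ContDiffAt ℝ 2 Ψ (0, x₀) ∧
      Ψ (0, x₀) = ContinuousMap.const _ x₀ ∧
      ∀ᶠ u in 𝓝 ((0 : ℝ), x₀), ∀ t : J,
        Ψ u t = u.2 + u.1 • ∫ s in (0 : ℝ)..t, X (extendCurve (Ψ u) s) := by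
  have hN : ContDiff ℝ 2 (fun β : C(J, E) => (⟨X, hX.continuous⟩ : C(E, E)).comp β) :=
    contDiff_postcomp 2 hX hc
  let c : E →L[ℝ] C(J, E) := ContinuousLinearMap.const ℝ J
  let G : (ℝ × E) × C(J, E) → C(J, E) := fun p =>
    p.2 - c p.1.2 - p.1.1 • primitiveOp E ((⟨X, hX.continuous⟩ : C(E, E)).comp p.2)
  have hG : ContDiff ℝ 2 G := by
    have h1 : ContDiff ℝ 2 (fun p : (ℝ × E) × C(J, E) =>
        primitiveOp E ((⟨X, hX.continuous⟩ : C(E, E)).comp p.2)) :=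
      (hN.comp contDiff_snd).continuousLinearMap_comp (primitiveOp E)
    have h2 : ContDiff ℝ 2 (fun p : (ℝ × E) × C(J, E) => c p.1.2) :=
      (contDiff_snd.comp contDiff_fst).continuousLinearMap_comp c
    exact (contDiff_snd.sub h2).sub ((contDiff_fst.comp contDiff_fst).smul h1)
  let u₀ : (ℝ × E) × C(J, E) := ((0, x₀), c x₀)
  have hG0 : G u₀ = 0 := by simp [G, u₀]
  have hd : fderiv ℝ G u₀ ∘L .inr ℝ (ℝ × E) C(J, E) = .id ℝ _ := by
    have h1 : HasFDerivAt (fun α : C(J, E) => G ((0, x₀), α))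
        (fderiv ℝ G u₀ ∘L .inr ℝ (ℝ × E) C(J, E)) (c x₀) :=
      ((hG.differentiable two_ne_zero) u₀).hasFDerivAt.comp (c x₀)
        (hasFDerivAt_prodMk_right (0, x₀) (c x₀))
    have h2 : HasFDerivAt (fun α : C(J, E) => G ((0, x₀), α)) (.id ℝ _) (c x₀) := by
      simpa [G] using (hasFDerivAt_id (𝕜 := ℝ) (c x₀)).sub_const (c x₀)
    exact h1.unique h2
  have hinv : (fderiv ℝ G u₀ ∘L .inr ℝ (ℝ × E) C(J, E)).IsInvertible := by
    rw [hd]; exact ⟨ContinuousLinearEquiv.refl ℝ _, rfl⟩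
  have hGa : ContDiffAt ℝ 2 G u₀ := hG.contDiffAt
  refine ⟨hGa.implicitFunction two_ne_zero hinv, hGa.contDiffAt_implicitFunction two_ne_zero hinv,
    hGa.implicitFunction_apply_self two_ne_zero hinv, ?_⟩
  filter_upwards [hGa.eventually_apply_implicitFunction two_ne_zero hinv] with u hu t
  rw [hG0] at hu
  have := congrArg (fun β : C(J, E) => β t) hu
  simp only [G, ContinuousMap.sub_apply, ContinuousMap.smul_apply, primitiveOp_apply,
    ContinuousMap.zero_apply] at this
  rw [sub_sub, sub_eq_zero] at this
  exact this

/-- The local flow of a `C²` field is `C²` jointly in time and initial point. The curve through `u.2`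
is only asserted for `u.1 ≠ 0`, because it is a rescaled solution `α` on `[-1, 1]` of
`α' = 2 u.1 X(α)`, read off at the interior time `1 / 2`. -/
theorem exists_contDiffAt_localFlow [FiniteDimensional ℝ E] {X : E → E} {U : Set E} (hU : IsOpen U)
    (hX : ContDiffOn ℝ 2 X U) {x₀ : E} (hx₀ : x₀ ∈ U) :
    ∃ Φ : ℝ × E → E, ContDiffAt ℝ 2 Φ (0, x₀) ∧
      (∀ᶠ x in 𝓝 x₀, Φ (0, x) = x) ∧
      ∀ᶠ u in 𝓝 ((0 : ℝ), x₀), u.1 ≠ 0 → ∃ (c : ℝ → E) (r : ℝ), |u.1| < r ∧ c 0 = u.2 ∧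
        c u.1 = Φ u ∧ ∀ s ∈ Ioo (-r) r, c s ∈ U ∧ HasDerivAt c (X (c s)) s := by
  have : CompleteSpace E := FiniteDimensional.complete ℝ E
  obtain ⟨R, hR, hRU⟩ := Metric.isOpen_iff.1 hU x₀ hx₀
  -- a cutoff of the field, equal to it on the ball of radius `R / 4`
  let χ : ContDiffBump x₀ := ⟨R / 4, R / 2, by positivity, by linarith⟩
  let Y : E → E := fun x => χ x • X x
  have hsupp : tsupport Y ⊆ U := by
    refine (tsupport_smul_subset_left χ X).trans ?_
    rw [χ.tsupport_eq]
    exact (Metric.closedBall_subset_ball (by change R / 2 < R; linarith)).trans hRU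
  have hY : ContDiff ℝ 2 Y := by
    rw [contDiff_iff_contDiffAt]
    intro x
    by_cases hx : x ∈ tsupport Y
    · exact χ.contDiffAt.smul (hX.contDiffAt (hU.mem_nhds (hsupp hx)))
    · exact contDiffAt_const.congr_of_eventuallyEq (notMem_tsupport_iff_eventuallyEq.1 hx)
  have hYc : HasCompactSupport Y := χ.hasCompactSupport.smul_right
  obtain ⟨Ψ, hΨ, hΨ0, hΨe⟩ := exists_contDiffAt_solution hY hYc x₀
  let half : J := ⟨1 / 2, by norm_num⟩
  have hdbl : ContDiff ℝ 2 (fun u : ℝ × E => (2 * u.1, u.2)) := by fun_prop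
  have htend : Tendsto (fun u : ℝ × E => (2 * u.1, u.2)) (𝓝 (0, x₀)) (𝓝 (0, x₀)) := by
    simpa using (hdbl.continuous.tendsto (0, x₀))
  refine ⟨fun u => Ψ (2 * u.1, u.2) half, ?_, ?_, ?_⟩
  · have h1 : ContDiffAt ℝ 2 (fun u : ℝ × E => Ψ (2 * u.1, u.2)) (0, x₀) :=
      ContDiffAt.comp (g := Ψ) (0, x₀) (by simpa using hΨ) hdbl.contDiffAt
    exact h1.continuousLinearMap_comp (ContinuousMap.evalCLM ℝ half)
  · have h1 : Tendsto (fun x : E => ((0 : ℝ), x)) (𝓝 x₀) (𝓝 (0, x₀)) :=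
      (by fun_prop : Continuous fun x : E => ((0 : ℝ), x)).tendsto x₀
    filter_upwards [h1.eventually hΨe] with x hx
    simp [hx half]
  · have hnear : ∀ᶠ u in 𝓝 ((0 : ℝ), x₀), ‖Ψ u - ContinuousMap.const _ x₀‖ < R / 4 := by
      have h1 : Tendsto Ψ (𝓝 (0, x₀)) (𝓝 (ContinuousMap.const _ x₀)) :=
        hΨ0 ▸ hΨ.continuousAt
      have h2 := h1.eventually (Metric.ball_mem_nhds _ (by positivity : (0 : ℝ) < R / 4))
      simpa only [dist_eq_norm] using h2
    filter_upwards [htend.eventually hΨe, htend.eventually hnear] with u hu hun hu0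
    set α := Ψ (2 * u.1, u.2)
    have hball : ∀ s, extendCurve α s ∈ Metric.ball x₀ (R / 4) := fun s => by
      rw [Metric.mem_ball, dist_eq_norm]
      exact (ContinuousMap.norm_coe_le_norm (α - ContinuousMap.const _ x₀) _).trans_lt hun
    have hYX : ∀ s, Y (extendCurve α s) = X (extendCurve α s) := fun s => by
      have : χ (extendCurve α s) = 1 :=
        χ.one_of_mem_closedBall (Metric.ball_subset_closedBall (hball s))
      simp [Y, this]
    have hcont : Continuous fun s => Y (extendCurve α s) :=
      hY.continuous.comp (continuous_extendCurve α)
    have h2 : 2 * u.1 ≠ 0 := by simpa using hu0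
    refine ⟨fun s => extendCurve α (s / (2 * u.1)), |2 * u.1|, ?_, ?_, ?_, ?_⟩
    · rw [abs_mul, abs_two]; linarith [abs_pos.2 hu0]
    · have h0 := hu ⟨0, by norm_num⟩
      have h1 := extendCurve_coe α ⟨0, by norm_num⟩
      simp only [intervalIntegral.integral_same, smul_zero, add_zero] at h0
      simpa [h0] using h1
    · have h1 := extendCurve_coe α half
      have h3 : u.1 / (2 * u.1) = 1 / 2 := by field_simp
      simp only [h3]
      exact h1
    · intro s hs
      refine ⟨hRU (Metric.ball_subset_ball (by linarith) (hball _)), ?_⟩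
      have hlt : ∀ s' ∈ Ioo (-|2 * u.1|) |2 * u.1|, s' / (2 * u.1) ∈ J := fun s' hs' => by
        rw [mem_Icc, ← abs_le, abs_div]
        exact div_le_one_of_le₀ (abs_lt.2 hs').le (abs_nonneg _)
      have heq : ∀ s' ∈ Ioo (-|2 * u.1|) |2 * u.1|, extendCurve α (s' / (2 * u.1)) =
          u.2 + (2 * u.1) • ∫ σ in (0 : ℝ)..(s' / (2 * u.1)), Y (extendCurve α σ) :=
        fun s' hs' => by
          rw [← hu ⟨_, hlt s' hs'⟩]
          exact extendCurve_coe α ⟨_, hlt s' hs'⟩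
      have hd : HasDerivAt (fun s' => u.2 + (2 * u.1) •
          ∫ σ in (0 : ℝ)..(s' / (2 * u.1)), Y (extendCurve α σ))
          (X (extendCurve α (s / (2 * u.1)))) s := by
        have h3 := intervalIntegral.integral_hasDerivAt_right
          (hcont.intervalIntegrable 0 (s / (2 * u.1)))
          (hcont.stronglyMeasurableAtFilter _ _) hcont.continuousAt
        have h4 := ((h3.scomp s ((hasDerivAt_id s).div_const (2 * u.1))).const_smul
          (2 * u.1)).const_add u.2
        rw [← hYX]
        rw [smul_smul, mul_one_div, div_self h2, one_smul] at h4
        exact h4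
      refine hd.congr_of_eventuallyEq ?_
      filter_upwards [Ioo_mem_nhds hs.1 hs.2] with s' hs'
      exact heq s' hs'

end LocalFlow

/-! ### Vector fields and curves in a chart -/

section Coordinates

variable {n : ℕ} {M : Type*} [TopologicalSpace M] [ChartedSpace (EuclideanSpace ℝ (Fin n)) M]
  [IsManifold (𝓡 n) ∞ M]

lemma mfderiv_extChartAt_symm_comp {x₀ p : M} (hp : p ∈ (extChartAt (𝓡 n) x₀).source) :
    (mfderiv 𝓘(ℝ, EuclideanSpace ℝ (Fin n)) (𝓡 n) (extChartAt (𝓡 n) x₀).symm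
      (extChartAt (𝓡 n) x₀ p)).comp
      (mfderiv (𝓡 n) 𝓘(ℝ, EuclideanSpace ℝ (Fin n)) (extChartAt (𝓡 n) x₀) p) =
    ContinuousLinearMap.id ℝ _ := by
  have h := mfderivWithin_extChartAt_symm_comp_mfderiv_extChartAt' (I := 𝓡 n) hp
  rw [ModelWithCorners.range_eq_univ, mfderivWithin_univ] at h
  exact h

lemma mfderiv_extChartAt_comp_symm {x₀ p : M} (hp : p ∈ (extChartAt (𝓡 n) x₀).source) :
    (mfderiv (𝓡 n) 𝓘(ℝ, EuclideanSpace ℝ (Fin n)) (extChartAt (𝓡 n) x₀) p).comp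
    (mfderiv 𝓘(ℝ, EuclideanSpace ℝ (Fin n)) (𝓡 n) (extChartAt (𝓡 n) x₀).symm
      (extChartAt (𝓡 n) x₀ p)) =
    ContinuousLinearMap.id ℝ _ := by
  have h := mfderiv_extChartAt_comp_mfderivWithin_extChartAt_symm' (I := 𝓡 n) hp
  rw [ModelWithCorners.range_eq_univ, mfderivWithin_univ] at h
  exact h

omit [IsManifold (𝓡 n) ∞ M] in
lemma coordField_extChartAt (X : (x : M) → TangentSpace (𝓡 n) x) {x₀ p : M}
    (hp : p ∈ (extChartAt (𝓡 n) x₀).source) :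
    coordField X x₀ (extChartAt (𝓡 n) x₀ p) =
      mfderiv (𝓡 n) 𝓘(ℝ, EuclideanSpace ℝ (Fin n)) (extChartAt (𝓡 n) x₀) p (X p) := by
  have h := (extChartAt (𝓡 n) x₀).left_inv hp
  exact congrArg (fun p' => (mfderiv (𝓡 n) 𝓘(ℝ, EuclideanSpace ℝ (Fin n)) (extChartAt (𝓡 n) x₀) p'
    (X p') : EuclideanSpace ℝ (Fin n))) h

lemma contDiffOn_coordField {X : (x : M) → TangentSpace (𝓡 n) x} (hX : IsSmoothField X) (x₀ : M) :
    ContDiffOn ℝ ∞ (coordField X x₀) (extChartAt (𝓡 n) x₀).target := by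
  have h1 := (Bundle.Trivialization.contMDiffOn_section_baseSet_iff (IB := 𝓡 n) (n := ∞) (s := X)
    (e := trivializationAt (EuclideanSpace ℝ (Fin n)) (TangentSpace (𝓡 n)) x₀)).1
    (ContMDiff.contMDiffOn hX)
  have h2 := h1.comp (contMDiffOn_extChartAt_symm (I := 𝓡 n) (n := ∞) x₀) (fun y hy => by
    have := (extChartAt (𝓡 n) x₀).map_target hy
    simpa using! this)
  rw [contMDiffOn_iff_contDiffOn] at h2
  refine h2.congr fun y hy => ?_
  have hy' := (extChartAt (𝓡 n) x₀).map_target hy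
  rw [extChartAt_source] at hy'
  have h3 := TangentBundle.continuousLinearMapAt_trivializationAt (I := 𝓡 n) (𝕜 := ℝ) hy'
  have h4 := DFunLike.congr_fun h3 (X ((extChartAt (𝓡 n) x₀).symm y))
  refine h4.symm.trans ?_
  rw [Bundle.Trivialization.continuousLinearMapAt_apply,
    Bundle.Trivialization.linearMapAt_apply, if_pos (by simpa using hy')]
  rfl

lemma hasDerivAt_extChartAt {X : (x : M) → TangentSpace (𝓡 n) x} {x₀ : M} {γ : ℝ → M} {t : ℝ}
    (ht : γ t ∈ (extChartAt (𝓡 n) x₀).source)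
    (hγ : HasMFDerivAt 𝓘(ℝ, ℝ) (𝓡 n) γ t ((1 : ℝ →L[ℝ] ℝ).smulRight (X (γ t)))) :
    HasDerivAt (fun s => extChartAt (𝓡 n) x₀ (γ s))
      (coordField X x₀ (extChartAt (𝓡 n) x₀ (γ t))) t := by
  let A : EuclideanSpace ℝ (Fin n) →L[ℝ] EuclideanSpace ℝ (Fin n) :=
    mfderiv (𝓡 n) 𝓘(ℝ, EuclideanSpace ℝ (Fin n)) (extChartAt (𝓡 n) x₀) (γ t)
  let v : EuclideanSpace ℝ (Fin n) := X (γ t)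
  have h1 : HasFDerivAt (fun s => extChartAt (𝓡 n) x₀ (γ s))
      (A.comp ((1 : ℝ →L[ℝ] ℝ).smulRight v)) t :=
    ((mdifferentiableAt_extChartAt (I := 𝓡 n)
      (by rwa [extChartAt_source] at ht)).hasMFDerivAt.comp t hγ).hasFDerivAt
  have h2 : coordField X x₀ (extChartAt (𝓡 n) x₀ (γ t)) = A v := coordField_extChartAt X ht
  rw [h2]
  simpa using h1.hasDerivAt

lemma hasMFDerivAt_extChartAt_symm {X : (x : M) → TangentSpace (𝓡 n) x} {x₀ : M}
    {c : ℝ → EuclideanSpace ℝ (Fin n)} {t : ℝ} (ht : c t ∈ (extChartAt (𝓡 n) x₀).target)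
    (hc : HasDerivAt c (coordField X x₀ (c t)) t) :
    HasMFDerivAt 𝓘(ℝ, ℝ) (𝓡 n) (fun s => (extChartAt (𝓡 n) x₀).symm (c s)) t
      ((1 : ℝ →L[ℝ] ℝ).smulRight (X ((extChartAt (𝓡 n) x₀).symm (c t)))) := by
  have h0 := mdifferentiableWithinAt_extChartAt_symm (I := 𝓡 n) ht
  rw [ModelWithCorners.range_eq_univ, mdifferentiableWithinAt_univ] at h0
  have hp := (extChartAt (𝓡 n) x₀).map_target ht
  have h2 := mfderiv_extChartAt_symm_comp hp
  rw [(extChartAt (𝓡 n) x₀).right_inv ht] at h2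
  let A : EuclideanSpace ℝ (Fin n) →L[ℝ] EuclideanSpace ℝ (Fin n) :=
    mfderiv 𝓘(ℝ, EuclideanSpace ℝ (Fin n)) (𝓡 n) (extChartAt (𝓡 n) x₀).symm (c t)
  let v : EuclideanSpace ℝ (Fin n) := X ((extChartAt (𝓡 n) x₀).symm (c t))
  have h3 : A (coordField X x₀ (c t)) = v :=
    DFunLike.congr_fun h2 (X ((extChartAt (𝓡 n) x₀).symm (c t)))
  have h4 : A.comp ((1 : ℝ →L[ℝ] ℝ).smulRight (coordField X x₀ (c t))) =
      (1 : ℝ →L[ℝ] ℝ).smulRight v := by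
    ext1
    simp [h3]
  have h1 : HasMFDerivAt 𝓘(ℝ, ℝ) (𝓡 n) (fun s => (extChartAt (𝓡 n) x₀).symm (c s)) t
      (A.comp ((1 : ℝ →L[ℝ] ℝ).smulRight (coordField X x₀ (c t)))) :=
    h0.hasMFDerivAt.comp t (HasDerivAt.hasFDerivAt hc).hasMFDerivAt
  exact HasMFDerivAt.congr_mfderiv h1 h4

end Coordinates

/-! ### Flows of complete fields -/

section Flow

variable {n : ℕ} {M : Type*} [TopologicalSpace M] [ChartedSpace (EuclideanSpace ℝ (Fin n)) M]
  {X : (x : M) → TangentSpace (𝓡 n) x}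

lemma isMIntegralCurve_flow (hc : IsCompleteField X) (x : M) :
    IsMIntegralCurve (fun t => flow X t x) X := by
  have h := (hc x).choose_spec.2
  convert! h using 2
  exact dif_pos (hc x)

lemma flow_zero (hc : IsCompleteField X) (x : M) : flow X 0 x = x := by
  have h := (hc x).choose_spec.1
  rw [flow, dif_pos (hc x)]
  exact h

variable [IsManifold (𝓡 n) ∞ M]

lemma IsSmoothField.contMDiff_one (hX : IsSmoothField X) :
    ContMDiff (𝓡 n) (𝓡 n).tangent 1 (fun x => (⟨x, X x⟩ : TangentBundle (𝓡 n) M)) :=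
  ContMDiff.of_le hX (by norm_cast)

variable [T2Space M]

/-- Uniqueness of integral curves identifies any local one with the flow. -/
lemma eq_flow_of_isMIntegralCurveOn (hX : IsSmoothField X) (hc : IsCompleteField X) {γ : ℝ → M}
    {r : ℝ} (hγ : IsMIntegralCurveOn γ X (Ioo (-r) r)) {t : ℝ} (ht : |t| < r) :
    γ t = flow X t (γ 0) := by
  have hr : 0 < r := (abs_nonneg t).trans_lt ht
  exact isMIntegralCurveOn_Ioo_eqOn_of_contMDiff_boundaryless (t₀ := 0) (by simpa using hr)
    hX.contMDiff_one hγ ((isMIntegralCurve_flow hc (γ 0)).isMIntegralCurveOn _)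
    (flow_zero hc _).symm (abs_lt.1 ht)

lemma flow_add (hX : IsSmoothField X) (hc : IsCompleteField X) (s t : ℝ) (x : M) :
    flow X (s + t) x = flow X s (flow X t x) := by
  have h1 : IsMIntegralCurve (fun r => flow X (r + t) x) X :=
    (isMIntegralCurve_flow hc x).comp_add t
  have h2 := eq_flow_of_isMIntegralCurveOn hX hc (h1.isMIntegralCurveOn (Ioo (-(|s| + 1)) (|s| + 1)))
    (t := s) (by linarith)
  simpa using h2

lemma flow_neg_flow (hX : IsSmoothField X) (hc : IsCompleteField X) (t : ℝ) (x : M) :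
    flow X (-t) (flow X t x) = x := by
  rw [← flow_add hX hc, neg_add_cancel, flow_zero hc]

lemma contMDiffAt_flow_zero (hX : IsSmoothField X) (hc : IsCompleteField X) (x₀ : M) :
    ContMDiffAt (𝓘(ℝ, ℝ).prod (𝓡 n)) (𝓡 n) 2 (fun p : ℝ × M => flow X p.1 p.2) (0, x₀) := by
  obtain ⟨Φ, hΦ, hΦ0, hΦe⟩ := exists_contDiffAt_localFlow (isOpen_extChartAt_target x₀)
    ((contDiffOn_coordField hX x₀).of_le (by norm_cast))
    (mem_extChartAt_target (I := 𝓡 n) x₀)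
  have hφ : ContMDiffAt (𝓡 n) 𝓘(ℝ, EuclideanSpace ℝ (Fin n)) 2 (extChartAt (𝓡 n) x₀) x₀ :=
    contMDiffAt_extChartAt
  have hpair : ContMDiffAt (𝓘(ℝ, ℝ).prod (𝓡 n)) 𝓘(ℝ, ℝ × EuclideanSpace ℝ (Fin n)) 2
      (fun p : ℝ × M => (p.1, extChartAt (𝓡 n) x₀ p.2)) (0, x₀) :=
    contMDiffAt_fst.prodMk_space (hφ.comp (0, x₀) contMDiffAt_snd)
  have hx₀ : Φ (0, extChartAt (𝓡 n) x₀ x₀) = extChartAt (𝓡 n) x₀ x₀ := hΦ0.self_of_nhds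
  have hsymm : ContMDiffAt 𝓘(ℝ, EuclideanSpace ℝ (Fin n)) (𝓡 n) 2 (extChartAt (𝓡 n) x₀).symm
      (Φ (0, extChartAt (𝓡 n) x₀ x₀)) := by
    rw [hx₀]
    exact (contMDiffOn_extChartAt_symm x₀).contMDiffAt (extChartAt_target_mem_nhds x₀)
  have hcomp : ContMDiffAt (𝓘(ℝ, ℝ).prod (𝓡 n)) (𝓡 n) 2
      (fun p : ℝ × M => (extChartAt (𝓡 n) x₀).symm (Φ (p.1, extChartAt (𝓡 n) x₀ p.2)))
      (0, x₀) :=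
    ContMDiffAt.comp (0, x₀) (g := (extChartAt (𝓡 n) x₀).symm) hsymm
      (ContMDiffAt.comp (0, x₀) (g := Φ) hΦ.contMDiffAt hpair)
  refine hcomp.congr_of_eventuallyEq ?_
  have hev1 : ∀ᶠ p : ℝ × M in 𝓝 (0, x₀),
      Φ (0, extChartAt (𝓡 n) x₀ p.2) = extChartAt (𝓡 n) x₀ p.2 :=
    by
    have h : Tendsto (fun p : ℝ × M => extChartAt (𝓡 n) x₀ p.2) (𝓝 (0, x₀))
        (𝓝 (extChartAt (𝓡 n) x₀ x₀)) :=
      (continuousAt_extChartAt (I := 𝓡 n) x₀).tendsto.comp continuousAt_snd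
    exact h.eventually hΦ0
  have hev2 : ∀ᶠ p : ℝ × M in 𝓝 (0, x₀), p.2 ∈ (extChartAt (𝓡 n) x₀).source :=
    continuousAt_snd.eventually_mem (extChartAt_source_mem_nhds x₀)
  filter_upwards [hpair.continuousAt.eventually hΦe, hev1, hev2] with p hp hp0 hps
  by_cases h0 : p.1 = 0
  · rw [h0, flow_zero hc, hp0, (extChartAt (𝓡 n) x₀).left_inv hps]
  · obtain ⟨c, r, hr, hc0, hc1, hcr⟩ := hp h0
    have hint : IsMIntegralCurveOn (fun s => (extChartAt (𝓡 n) x₀).symm (c s)) X (Ioo (-r) r) :=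
      fun s hs => (hasMFDerivAt_extChartAt_symm (hcr s hs).1 (hcr s hs).2).hasMFDerivWithinAt
    have := eq_flow_of_isMIntegralCurveOn hX hc hint hr
    simp only [hc0, (extChartAt (𝓡 n) x₀).left_inv hps] at this
    rw [← this, hc1]

/-- The flow of a smooth complete field is `C²` jointly in time and initial point: by the group law
the set of times at which it is `C²` along an orbit is open and closed. -/
theorem contMDiff_flow (hX : IsSmoothField X) (hc : IsCompleteField X) :
    ContMDiff (𝓘(ℝ, ℝ).prod (𝓡 n)) (𝓡 n) 2 (fun p : ℝ × M => flow X p.1 p.2) := by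
  rintro ⟨t, x⟩
  let S : Set ℝ := {s | ContMDiffAt (𝓘(ℝ, ℝ).prod (𝓡 n)) (𝓡 n) 2
    (fun p : ℝ × M => flow X p.1 p.2) (s, x)}
  have hcont : Continuous (fun s => flow X s x) := (isMIntegralCurve_flow hc x).continuous
  -- near each time `s₀`, being `C²` at one nearby time propagates to all nearby times
  have key : ∀ s₀ : ℝ, ∀ᶠ p : ℝ × ℝ in 𝓝 (s₀, s₀), p.1 ∈ S → p.2 ∈ S := by
    intro s₀
    have h1 : ∀ᶠ p : ℝ × M in 𝓝 (0, flow X s₀ x), ContMDiffAt (𝓘(ℝ, ℝ).prod (𝓡 n)) (𝓡 n) 2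
        (fun p : ℝ × M => flow X p.1 p.2) p :=
      (contMDiffAt_iff_contMDiffAt_nhds (by decide)).1 (contMDiffAt_flow_zero hX hc (flow X s₀ x))
    have h2 : Tendsto (fun p : ℝ × ℝ => (p.2 - p.1, flow X p.1 x)) (𝓝 (s₀, s₀))
        (𝓝 (0, flow X s₀ x)) := by
      have : Continuous (fun p : ℝ × ℝ => (p.2 - p.1, flow X p.1 x)) := by fun_prop
      simpa using this.tendsto (s₀, s₀)
    filter_upwards [h2.eventually h1] with p hp hS
    have h3 : ContMDiffAt (𝓘(ℝ, ℝ).prod (𝓡 n)) (𝓡 n) 2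
        (fun z : ℝ × M => flow X p.1 z.2) (p.2, x) :=
      ContMDiffAt.comp (p.2, x) (g := fun z : ℝ × M => flow X z.1 z.2)
        (f := fun z : ℝ × M => (p.1, z.2)) hS (contMDiffAt_const.prodMk contMDiffAt_snd)
    have h4 : ContMDiffAt (𝓘(ℝ, ℝ).prod (𝓡 n)) 𝓘(ℝ, ℝ) 2
        (fun z : ℝ × M => z.1 - p.1) (p.2, x) := contMDiffAt_fst.sub contMDiffAt_const
    have h5 : ContMDiffAt (𝓘(ℝ, ℝ).prod (𝓡 n)) (𝓡 n) 2
        (fun z : ℝ × M => flow X (z.1 - p.1) (flow X p.1 z.2)) (p.2, x) :=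
      ContMDiffAt.comp (p.2, x) (g := fun z : ℝ × M => flow X z.1 z.2)
        (f := fun z : ℝ × M => (z.1 - p.1, flow X p.1 z.2)) hp (h4.prodMk h3)
    refine h5.congr_of_eventuallyEq (Eventually.of_forall fun z => ?_)
    simp only
    rw [← flow_add hX hc, sub_add_cancel]
  have hopen : IsOpen S := by
    rw [isOpen_iff_mem_nhds]
    intro s hs
    have h : Tendsto (fun s' => (s, s')) (𝓝 s) (𝓝 (s, s)) :=
      (by fun_prop : Continuous fun s' : ℝ => (s, s')).tendsto s
    filter_upwards [h.eventually (key s)] with s' hs' using hs' hs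
  have hclosed : IsClosed S := by
    rw [← isOpen_compl_iff, isOpen_iff_mem_nhds]
    intro s hs
    have h : Tendsto (fun s' => (s', s)) (𝓝 s) (𝓝 (s, s)) :=
      (by fun_prop : Continuous fun s' : ℝ => (s', s)).tendsto s
    filter_upwards [h.eventually (key s)] with s' hs' hS using hs (hs' hS)
  have huniv : S = univ :=
    IsClopen.eq_univ ⟨hclosed, hopen⟩ ⟨0, contMDiffAt_flow_zero hX hc x⟩
  exact huniv.ge (mem_univ t)

end Flow

/-! ### Rank and range of linear maps -/

section LinearAlgebra

variable {V E : Type*} [NormedAddCommGroup V] [NormedSpace ℝ V] [NormedAddCommGroup E]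
  [NormedSpace ℝ E] [FiniteDimensional ℝ E]

lemma isOpen_le_finrank_range (k : ℕ) :
    IsOpen {A : V →L[ℝ] E | k ≤ Module.finrank ℝ (LinearMap.range (A : V →ₗ[ℝ] E))} := by
  convert! isOpen_setOfPred_nat_le_rank (𝕜 := ℝ) (E := V) (F := E) k using 3 with A
  rw [LinearMap.rank, ← Module.finrank_eq_rank]
  norm_cast

lemma surjective_iff_finrank_le (A : V →L[ℝ] E) :
    Function.Surjective A ↔
      Module.finrank ℝ E ≤ Module.finrank ℝ (LinearMap.range (A : V →ₗ[ℝ] E)) := by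
  constructor
  · intro h
    rw [LinearMap.range_eq_top.2 h, finrank_top]
  · intro h
    exact LinearMap.range_eq_top.1 (Submodule.eq_top_of_finrank_eq
      (le_antisymm (Submodule.finrank_le _) h))

lemma isOpen_surjective : IsOpen {A : V →L[ℝ] E | Function.Surjective A} := by
  simpa only [surjective_iff_finrank_le] using isOpen_le_finrank_range (V := V) (E := E) _

/-- Spanning by finitely many continuous vector functions is an open condition. -/
lemma eventually_span_eq_top {T ι : Type*} [TopologicalSpace T] {t₀ : T} (B : Finset ι)
    {Z : ι → T → E} (hZ : ∀ i ∈ B, ContinuousAt (Z i) t₀)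
    (h : Submodule.span ℝ {v | ∃ i ∈ B, v = Z i t₀} = ⊤) :
    ∀ᶠ t in 𝓝 t₀, Submodule.span ℝ {v | ∃ i ∈ B, v = Z i t} = ⊤ := by
  classical
  let A : T → (B → ℝ) →L[ℝ] E := fun t =>
    ∑ i : B, (ContinuousLinearMap.proj (R := ℝ) (φ := fun _ : B => ℝ) i).smulRight (Z i t)
  have hA : ContinuousAt A t₀ := by
    refine tendsto_finsetSum _ fun i _ => ?_
    exact (((ContinuousLinearMap.smulRightL ℝ (B → ℝ) E)
      (ContinuousLinearMap.proj (R := ℝ) (φ := fun _ : B => ℝ) i)).continuous.tendsto _).comp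
      (hZ i i.2)
  have hspan : ∀ t, Submodule.span ℝ {v | ∃ i ∈ B, v = Z i t} =
      LinearMap.range (A t : (B → ℝ) →ₗ[ℝ] E) := by
    intro t
    apply le_antisymm
    · rw [Submodule.span_le]
      rintro v ⟨i, hi, rfl⟩
      refine ⟨Pi.single ⟨i, hi⟩ 1, ?_⟩
      simp only [A, ContinuousLinearMap.coe_coe, sum_apply,
        ContinuousLinearMap.smulRight_apply, ContinuousLinearMap.proj_apply]
      rw [Finset.sum_eq_single ⟨i, hi⟩]
      · simp
      · intro j _ hj; simp [Pi.single_eq_of_ne hj]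
      · simp
    · rintro _ ⟨c, rfl⟩
      simp only [A, ContinuousLinearMap.coe_coe, sum_apply,
        ContinuousLinearMap.smulRight_apply, ContinuousLinearMap.proj_apply]
      exact Submodule.sum_mem _ fun i _ => Submodule.smul_mem _ _
        (Submodule.subset_span ⟨i, i.2, rfl⟩)
  simp only [hspan, LinearMap.range_eq_top] at h ⊢
  exact hA.eventually_mem (isOpen_surjective.mem_nhds h)

omit [FiniteDimensional ℝ E] in
lemma range_fderiv_comp_le {V' : Type*} [NormedAddCommGroup V'] [NormedSpace ℝ V'] {f : V → E}
    {g : V' → V} {x : V'} (hf : DifferentiableAt ℝ f (g x)) (hg : DifferentiableAt ℝ g x) :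
    LinearMap.range (fderiv ℝ (fun y => f (g y)) x : V' →ₗ[ℝ] E) ≤
      LinearMap.range (fderiv ℝ f (g x) : V →ₗ[ℝ] E) := by
  have : fderiv ℝ (fun y => f (g y)) x = (fderiv ℝ f (g x)).comp (fderiv ℝ g x) :=
    fderiv_comp x hf hg
  rw [this]
  exact LinearMap.range_comp_le_range _ _

end LinearAlgebra

/-! ### Fields tangent to the image of a map -/

section Tangency

variable {V E : Type*} [NormedAddCommGroup V] [NormedSpace ℝ V] [FiniteDimensional ℝ V]
  [NormedAddCommGroup E] [NormedSpace ℝ E] [FiniteDimensional ℝ E]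

/-- A field tangent to an immersion `ψ` lifts to a differentiable field in the parameters. -/
lemma exists_lift_of_mem_range {ψ : V → E} {v₀ : V} (hψ : ContDiffAt ℝ 2 ψ v₀)
    (hinj : Function.Injective (fderiv ℝ ψ v₀)) {X : E → E} (hX : DifferentiableAt ℝ X (ψ v₀))
    (hXt : ∀ᶠ v in 𝓝 v₀, X (ψ v) ∈ LinearMap.range (fderiv ℝ ψ v : V →ₗ[ℝ] E)) :
    ∃ a : V → V, DifferentiableAt ℝ a v₀ ∧ ∀ᶠ v in 𝓝 v₀, X (ψ v) = fderiv ℝ ψ v (a v) := by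
  have : CompleteSpace V := FiniteDimensional.complete ℝ V
  obtain ⟨P₀, hP₀⟩ := LinearMap.exists_leftInverse_of_injective
    (fderiv ℝ ψ v₀ : V →ₗ[ℝ] E) (LinearMap.ker_eq_bot.2 hinj)
  let P : E →L[ℝ] V := P₀.toContinuousLinearMap
  have hP : P.comp (fderiv ℝ ψ v₀) = ContinuousLinearEquiv.refl ℝ V := by
    ext v; exact DFunLike.congr_fun hP₀ v
  have hD : ContDiffAt ℝ 1 (fderiv ℝ ψ) v₀ := hψ.fderiv_right (by norm_num)
  let L : V → V →L[ℝ] V := fun v => P.comp (fderiv ℝ ψ v)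
  have hL : ContDiffAt ℝ 1 L v₀ := contDiffAt_const.clm_comp hD
  have hLinv : ContDiffAt ℝ 1 (fun v => (L v).inverse) v₀ := by
    have h := contDiffAt_map_inverse (𝕜 := ℝ) (n := 1) (ContinuousLinearEquiv.refl ℝ V)
    rw [← hP] at h
    exact ContDiffAt.comp v₀ (g := ContinuousLinearMap.inverse) (f := L) h hL
  refine ⟨fun v => (L v).inverse (P (X (ψ v))), ?_, ?_⟩
  · refine (hLinv.differentiableAt one_ne_zero).clm_apply ?_
    exact P.differentiableAt.comp v₀ (hX.comp v₀ (hψ.differentiableAt two_ne_zero))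
  · have h1 : ∀ᶠ v in 𝓝 v₀, L v ∈ range ((↑) : (V ≃L[ℝ] V) → V →L[ℝ] V) :=
      hL.continuousAt.eventually_mem (by
        change _ ∈ 𝓝 (P.comp (fderiv ℝ ψ v₀))
        rw [hP]
        exact ContinuousLinearEquiv.nhds _)
    filter_upwards [h1, hXt] with v hv ⟨w, hw⟩
    have hw' : X (ψ v) = fderiv ℝ ψ v w := hw.symm
    obtain ⟨e, he⟩ := hv
    have h2 : P (X (ψ v)) = L v w := by rw [hw']; rfl
    rw [h2, ← he, ContinuousLinearMap.inverse_equiv]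
    simp [hw']

/-- Fields tangent to an immersion have a tangent Lie bracket. -/
lemma lieBracket_mem_range_fderiv {ψ : V → E} {v₀ : V} (hψ : ContDiffAt ℝ 2 ψ v₀)
    (hinj : Function.Injective (fderiv ℝ ψ v₀)) {X Y : E → E}
    (hX : DifferentiableAt ℝ X (ψ v₀)) (hY : DifferentiableAt ℝ Y (ψ v₀))
    (hXt : ∀ᶠ v in 𝓝 v₀, X (ψ v) ∈ LinearMap.range (fderiv ℝ ψ v : V →ₗ[ℝ] E))
    (hYt : ∀ᶠ v in 𝓝 v₀, Y (ψ v) ∈ LinearMap.range (fderiv ℝ ψ v : V →ₗ[ℝ] E)) :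
    VectorField.lieBracket ℝ X Y (ψ v₀) ∈ LinearMap.range (fderiv ℝ ψ v₀ : V →ₗ[ℝ] E) := by
  obtain ⟨a, ha, hXa⟩ := exists_lift_of_mem_range hψ hinj hX hXt
  obtain ⟨b, hb, hYb⟩ := exists_lift_of_mem_range hψ hinj hY hYt
  have hD : HasFDerivAt (fderiv ℝ ψ) (fderiv ℝ (fderiv ℝ ψ) v₀) v₀ :=
    ((hψ.fderiv_right (m := 1) (by norm_num)).differentiableAt one_ne_zero).hasFDerivAt
  have hsymm : IsSymmSndFDerivAt ℝ ψ v₀ := hψ.isSymmSndFDerivAt (by simp)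
  have key : ∀ {Z : E → E} {c : V → V}, DifferentiableAt ℝ Z (ψ v₀) → DifferentiableAt ℝ c v₀ →
      (∀ᶠ v in 𝓝 v₀, Z (ψ v) = fderiv ℝ ψ v (c v)) → ∀ w, fderiv ℝ Z (ψ v₀) (fderiv ℝ ψ v₀ w) =
        fderiv ℝ ψ v₀ (fderiv ℝ c v₀ w) + fderiv ℝ (fderiv ℝ ψ) v₀ w (c v₀) := by
    intro Z c hZ hc hZc w
    have h1 : HasFDerivAt (fun v => Z (ψ v)) ((fderiv ℝ Z (ψ v₀)).comp (fderiv ℝ ψ v₀)) v₀ :=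
      hZ.hasFDerivAt.comp v₀ (hψ.differentiableAt two_ne_zero).hasFDerivAt
    have h2 := (hD.clm_apply hc.hasFDerivAt).congr_of_eventuallyEq hZc
    have h3 := DFunLike.congr_fun (h1.unique h2) w
    simpa using h3
  refine ⟨fderiv ℝ b v₀ (a v₀) - fderiv ℝ a v₀ (b v₀), ?_⟩
  have h1 := key hX ha hXa (b v₀)
  have h2 := key hY hb hYb (a v₀)
  rw [← hYb.self_of_nhds] at h1
  rw [← hXa.self_of_nhds] at h2
  rw [VectorField.lieBracket, h1, h2, hsymm.eq (b v₀) (a v₀)]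
  simp

end Tangency

/-! ### Iterated brackets in coordinates -/

section Brackets

variable {n : ℕ} {M : Type*} [TopologicalSpace M] [ChartedSpace (EuclideanSpace ℝ (Fin n)) M]
  [IsManifold (𝓡 n) ∞ M]

variable (n M) in
lemma isManifold_minSmoothness : IsManifold (𝓡 n) (minSmoothness ℝ 2) M := by
  rw [minSmoothness_of_isRCLikeNormedField]; infer_instance

lemma IsSmoothField.mlieBracket {X Y : (x : M) → TangentSpace (𝓡 n) x} (hX : IsSmoothField X)
    (hY : IsSmoothField Y) : IsSmoothField (VectorField.mlieBracket (𝓡 n) X Y) := by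
  have := isManifold_minSmoothness n M
  have : IsManifold (𝓡 n) ((⊤ : ℕ∞) + 1) M := by
    change IsManifold (𝓡 n) ∞ M; infer_instance
  exact ContDiff.mlieBracket_vectorField (n := ⊤) (m := ⊤) hX hY (by simp)

lemma isSmoothField_iterBracket {ι : Type*} {W : ι → (x : M) → TangentSpace (𝓡 n) x}
    (hW : ∀ i, IsSmoothField (W i)) : ∀ β : List ι, IsSmoothField (iterBracket W β)
  | [] => Bundle.contMDiff_zeroSection ℝ (TangentSpace (𝓡 n) : M → Type)
  | [a] => hW a
  | a :: b :: l => (hW a).mlieBracket (isSmoothField_iterBracket hW (b :: l))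

lemma coordField_eq_mpullback (X : (x : M) → TangentSpace (𝓡 n) x) (x₀ : M)
    {y : EuclideanSpace ℝ (Fin n)} (hy : y ∈ (extChartAt (𝓡 n) x₀).target) :
    coordField X x₀ y = VectorField.mpullback 𝓘(ℝ, EuclideanSpace ℝ (Fin n)) (𝓡 n)
      (extChartAt (𝓡 n) x₀).symm X y := by
  have hp := (extChartAt (𝓡 n) x₀).map_target hy
  have h1 := mfderiv_extChartAt_symm_comp hp
  have h2 := mfderiv_extChartAt_comp_symm hp
  rw [(extChartAt (𝓡 n) x₀).right_inv hy] at h1 h2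
  have h3 := ContinuousLinearMap.inverse_eq h1 h2
  exact (DFunLike.congr_fun h3 (X ((extChartAt (𝓡 n) x₀).symm y))).symm

lemma coordField_mlieBracket {X Y : (x : M) → TangentSpace (𝓡 n) x} (hX : IsSmoothField X)
    (hY : IsSmoothField Y) (x₀ : M) {y : EuclideanSpace ℝ (Fin n)}
    (hy : y ∈ (extChartAt (𝓡 n) x₀).target) :
    coordField (VectorField.mlieBracket (𝓡 n) X Y) x₀ y =
      VectorField.lieBracket ℝ (coordField X x₀) (coordField Y x₀) y := by
  have := isManifold_minSmoothness n M
  have hnhds : (extChartAt (𝓡 n) x₀).target ∈ 𝓝 y := (isOpen_extChartAt_target x₀).mem_nhds hy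
  rw [coordField_eq_mpullback _ _ hy, VectorField.mpullback_mlieBracket (n := 2)
    (ContMDiffAt.mdifferentiableAt (ContMDiff.contMDiffAt hX) (by simp))
    (ContMDiffAt.mdifferentiableAt (ContMDiff.contMDiffAt hY) (by simp))
    ((contMDiffOn_extChartAt_symm x₀).contMDiffAt hnhds) (by simp),
    ← VectorField.mlieBracketWithin_univ, VectorField.mlieBracketWithin_eq_lieBracketWithin]
  refine (congrFun VectorField.lieBracketWithin_univ y).trans ?_
  apply Filter.EventuallyEq.lieBracket_vectorField_eq
  · filter_upwards [hnhds] with z hz using (coordField_eq_mpullback X x₀ hz).symm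
  · filter_upwards [hnhds] with z hz using (coordField_eq_mpullback Y x₀ hz).symm

end Brackets

/-! ### Points at which a parametrization is submersive -/

section ParametrizedPoints

variable {n : ℕ} {M : Type*} [TopologicalSpace M] [ChartedSpace (EuclideanSpace ℝ (Fin n)) M]
  [IsManifold (𝓡 n) ∞ M] {V : Type*} [NormedAddCommGroup V] [NormedSpace ℝ V]

lemma contDiffAt_extChartAt_comp {f : V → M} {t : V} (hf : ContMDiffAt 𝓘(ℝ, V) (𝓡 n) 2 f t)
    {x₀ : M} (ht : f t ∈ (extChartAt (𝓡 n) x₀).source) :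
    ContDiffAt ℝ 2 (fun s => extChartAt (𝓡 n) x₀ (f s)) t := by
  rw [← contMDiffAt_iff_contDiffAt]
  exact ContMDiffAt.comp t (contMDiffAt_extChartAt' (by rwa [extChartAt_source] at ht)) hf

lemma surjective_mfderiv_iff {f : V → M} {t : V} (hf : MDifferentiableAt 𝓘(ℝ, V) (𝓡 n) f t)
    {x₀ : M} (ht : f t ∈ (extChartAt (𝓡 n) x₀).source) :
    Function.Surjective (mfderiv 𝓘(ℝ, V) (𝓡 n) f t) ↔
      Function.Surjective (fderiv ℝ (fun s => extChartAt (𝓡 n) x₀ (f s)) t) := by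
  have h1 := mfderiv_comp t (mdifferentiableAt_extChartAt (I := 𝓡 n) (x := x₀)
    (by rwa [extChartAt_source] at ht)) hf
  rw [mfderiv_eq_fderiv] at h1
  have h2 : ∀ v, fderiv ℝ (fun s => extChartAt (𝓡 n) x₀ (f s)) t v =
    mfderiv (𝓡 n) 𝓘(ℝ, EuclideanSpace ℝ (Fin n)) (extChartAt (𝓡 n) x₀) (f t)
      (mfderiv 𝓘(ℝ, V) (𝓡 n) f t v) := fun v => DFunLike.congr_fun h1 v
  have h3 := mfderiv_extChartAt_symm_comp ht
  have h4 := mfderiv_extChartAt_comp_symm ht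
  have hbij : Function.Bijective (mfderiv (𝓡 n) 𝓘(ℝ, EuclideanSpace ℝ (Fin n))
      (extChartAt (𝓡 n) x₀) (f t)) :=
    ⟨Function.LeftInverse.injective (fun v => DFunLike.congr_fun h3 v),
      Function.RightInverse.surjective (fun v => DFunLike.congr_fun h4 v)⟩
  have h5 : (fun v => fderiv ℝ (fun s => extChartAt (𝓡 n) x₀ (f s)) t v) =
    (mfderiv (𝓡 n) 𝓘(ℝ, EuclideanSpace ℝ (Fin n)) (extChartAt (𝓡 n) x₀) (f t)) ∘
      (mfderiv 𝓘(ℝ, V) (𝓡 n) f t) := funext h2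
  change _ ↔ Function.Surjective (fun v => fderiv ℝ (fun s => extChartAt (𝓡 n) x₀ (f s)) t v)
  rw [h5]
  exact ⟨fun h => hbij.2.comp h, fun h => Function.Surjective.of_comp_left h hbij.1⟩

/-- The points reached from an open set of parameters at which the differential is onto form an open
set. -/
lemma isOpen_image_surjective [FiniteDimensional ℝ V] {f : V → M}
    (hf : ContMDiff 𝓘(ℝ, V) (𝓡 n) 2 f) {P : Set V} (hP : IsOpen P) :
    IsOpen {p | ∃ t ∈ P, Function.Surjective (mfderiv 𝓘(ℝ, V) (𝓡 n) f t) ∧ f t = p} := by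
  have : CompleteSpace V := FiniteDimensional.complete ℝ V
  rw [isOpen_iff_mem_nhds]
  rintro _ ⟨t, htP, hts, rfl⟩
  set x₀ := f t
  set φ := extChartAt (𝓡 n) x₀
  let G : V → EuclideanSpace ℝ (Fin n) := fun s => φ (f s)
  have hmd : ∀ s, MDifferentiableAt 𝓘(ℝ, V) (𝓡 n) f s := fun s =>
    (hf s).mdifferentiableAt (by simp)
  have hx₀ : f t ∈ φ.source := mem_extChartAt_source x₀
  have hG : ContDiffAt ℝ 2 G t := contDiffAt_extChartAt_comp (hf t) hx₀
  have hGs : Function.Surjective (fderiv ℝ G t) := (surjective_mfderiv_iff (hmd t) hx₀).1 hts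
  have hmap : map G (𝓝 t) = 𝓝 (G t) :=
    (hG.hasStrictFDerivAt two_ne_zero).map_nhds_eq_of_surj (LinearMap.range_eq_top.2 hGs)
  have hev : ∀ᶠ s in 𝓝 t, s ∈ P ∧ f s ∈ φ.source ∧ Function.Surjective (fderiv ℝ G s) :=
    (hP.eventually_mem htP).and ((hf.continuous.continuousAt.eventually_mem
      (extChartAt_source_mem_nhds x₀)).and
      ((hG.fderiv_right (m := 1) (by norm_num)).continuousAt.eventually_mem
        (isOpen_surjective.mem_nhds hGs)))
  have him : G '' {s | s ∈ P ∧ f s ∈ φ.source ∧ Function.Surjective (fderiv ℝ G s)} ∈ 𝓝 (G t) := by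
    rw [← hmap]; exact image_mem_map hev
  filter_upwards [(continuousAt_extChartAt x₀).eventually_mem him,
    extChartAt_source_mem_nhds (I := 𝓡 n) x₀] with p ⟨s, ⟨hsP, hss, hsr⟩, hsp⟩ hp
  exact ⟨s, hsP, (surjective_mfderiv_iff (hmd s) hss).2 hsr, φ.injOn hss hp hsp⟩

end ParametrizedPoints

/-! ### Chronological products -/

section ChronologicalProducts

variable {n : ℕ} {M : Type*} [TopologicalSpace M] [T2Space M]
  [ChartedSpace (EuclideanSpace ℝ (Fin n)) M] [IsManifold (𝓡 n) ∞ M]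
  {ι : Type*} {W : ι → (x : M) → TangentSpace (𝓡 n) x}

lemma contMDiff_chronProduct (hW : ∀ i, IsSmoothField (W i)) (hc : ∀ i, IsCompleteField (W i))
    (q : M) : ∀ w : List ι, ContMDiff 𝓘(ℝ, Fin w.length → ℝ) (𝓡 n) 2
      (fun t : Fin w.length → ℝ => chronProduct W w t q)
  | [] => contMDiff_const
  | a :: w => by
    have h1 : ContMDiff 𝓘(ℝ, Fin (w.length + 1) → ℝ) 𝓘(ℝ, Fin w.length → ℝ) 2
        (fun t : Fin (w.length + 1) → ℝ => Fin.tail t) := by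
      rw [contMDiff_iff_contDiff, contDiff_pi]
      exact fun i => contDiff_apply ℝ ℝ i.succ
    have h2 : ContMDiff 𝓘(ℝ, Fin (w.length + 1) → ℝ) 𝓘(ℝ, ℝ) 2
        (fun t : Fin (w.length + 1) → ℝ => t 0) := by
      rw [contMDiff_iff_contDiff]
      exact contDiff_apply ℝ ℝ 0
    exact (contMDiff_flow (hW a) (hc a)).comp
      (h2.prodMk ((contMDiff_chronProduct hW hc q w).comp h1))

lemma isOpen_regularPoints (hW : ∀ i, IsSmoothField (W i)) (hc : ∀ i, IsCompleteField (W i))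
    (q : M) (w : List ι) : IsOpen (regularPoints W w q) := by
  have hP : IsOpen {t : Fin w.length → ℝ | ∀ i, 0 < t i} := by
    simp only [ofPred_forall]
    exact isOpen_iInter_of_finite fun i => isOpen_lt continuous_const (continuous_apply i)
  have h := isOpen_image_surjective (contMDiff_chronProduct hW hc q w) hP
  simpa [regularPoints, zeroSet] using h

/-- Prepending a letter keeps a parameter regular, because each flow map is a diffeomorphism. -/
lemma surjective_mfderiv_chronProduct_cons (hW : ∀ i, IsSmoothField (W i))
    (hc : ∀ i, IsCompleteField (W i)) {q : M} {w : List ι} {t : Fin w.length → ℝ}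
    (ht : t ∉ zeroSet W w q) (a : ι) (τ : ℝ) :
    (Fin.cons τ t : Fin (w.length + 1) → ℝ) ∉ zeroSet W (a :: w) q := by
  simp only [zeroSet, mem_ofPred_eq, not_not] at ht
  refine not_not.2 ?_
  let F : (Fin (w.length + 1) → ℝ) → M := fun s => chronProduct W (a :: w) s q
  let f : (Fin w.length → ℝ) → M := fun s => chronProduct W w s q
  let c : (Fin w.length → ℝ) → (Fin (w.length + 1) → ℝ) := fun s => Fin.cons τ s
  have hF : MDifferentiable 𝓘(ℝ, Fin (w.length + 1) → ℝ) (𝓡 n) F :=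
    (contMDiff_chronProduct hW hc q (a :: w)).mdifferentiable (by simp)
  have hf : MDifferentiable 𝓘(ℝ, Fin w.length → ℝ) (𝓡 n) f :=
    (contMDiff_chronProduct hW hc q w).mdifferentiable (by simp)
  have hcd : MDifferentiable 𝓘(ℝ, Fin w.length → ℝ) 𝓘(ℝ, Fin (w.length + 1) → ℝ) c := by
    rw [mdifferentiable_iff_differentiable, differentiable_pi]
    refine Fin.cases ?_ fun i => ?_
    · simp [c]
    · simpa [c] using differentiable_apply i
  have hflow : ∀ r, MDifferentiable (𝓡 n) (𝓡 n) (flow (W a) r) := fun r =>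
    ((contMDiff_flow (hW a) (hc a)).comp
      (contMDiff_const.prodMk contMDiff_id : ContMDiff (𝓡 n) (𝓘(ℝ, ℝ).prod (𝓡 n)) 2
        fun x : M => (r, x))).mdifferentiable (by simp)
  have heq : F ∘ c = flow (W a) τ ∘ f := by
    funext s
    simp [F, c, f, chronProduct]
  have h1 := mfderiv_comp t (hF (c t)) (hcd t)
  have h2 := mfderiv_comp t (hflow τ (f t)) (hf t)
  have hid : flow (W a) τ ∘ flow (W a) (-τ) = id := by
    funext x
    have := flow_neg_flow (hW a) (hc a) (-τ) x
    rwa [neg_neg] at this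
  have h3 := mfderiv_comp (flow (W a) τ (f t)) (hflow τ (flow (W a) (-τ) (flow (W a) τ (f t))))
    (hflow (-τ) _)
  rw [hid, mfderiv_id, flow_neg_flow (hW a) (hc a)] at h3
  have hsurj : Function.Surjective (mfderiv (𝓡 n) (𝓡 n) (flow (W a) τ) (f t)) :=
    Function.RightInverse.surjective (fun v => (DFunLike.congr_fun h3 v).symm)
  have h4 : Function.Surjective (mfderiv 𝓘(ℝ, Fin w.length → ℝ) (𝓡 n) (F ∘ c) t) := by
    rw [heq, h2]
    exact hsurj.comp ht
  rw [h1] at h4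
  exact Function.Surjective.of_comp (f := mfderiv 𝓘(ℝ, Fin (w.length + 1) → ℝ) (𝓡 n) F (c t))
    (g := mfderiv 𝓘(ℝ, Fin w.length → ℝ) 𝓘(ℝ, Fin (w.length + 1) → ℝ) c t) h4

lemma regularPoints_append_nonempty (hW : ∀ i, IsSmoothField (W i))
    (hc : ∀ i, IsCompleteField (W i)) {q : M} {w : List ι} (h : (regularPoints W w q).Nonempty) :
    ∀ m : List ι, (regularPoints W (m ++ w) q).Nonempty
  | [] => h
  | a :: m => by
    obtain ⟨_, t, htpos, ht, -⟩ := regularPoints_append_nonempty hW hc h m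
    refine ⟨_, (Fin.cons 1 t : Fin ((m ++ w).length + 1) → ℝ), ?_,
      surjective_mfderiv_chronProduct_cons hW hc ht a 1, rfl⟩
    exact Fin.cases (by simp) (by simpa using htpos)

/-- If the field `W a` is not tangent to the image of the chronological product along `w`, then the
product along `a :: w` has larger rank for small positive times along `W a`. -/
lemma exists_pos_finrank_lt (hW : ∀ i, IsSmoothField (W i)) (hc : ∀ i, IsCompleteField (W i))
    {q x₀ : M} {w : List ι} {s : Fin w.length → ℝ} {O : Set M} (hO : IsOpen O)
    (hOs : O ⊆ (extChartAt (𝓡 n) x₀).source) (hs : chronProduct W w s q ∈ O) {a : ι}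
    (ha : coordField (W a) x₀ (extChartAt (𝓡 n) x₀ (chronProduct W w s q)) ∉
      LinearMap.range (fderiv ℝ (fun s : Fin w.length → ℝ =>
        extChartAt (𝓡 n) x₀ (chronProduct W w s q)) s :
          (Fin w.length → ℝ) →ₗ[ℝ] EuclideanSpace ℝ (Fin n))) :
    ∃ τ : ℝ, 0 < τ ∧ chronProduct W (a :: w) (Fin.cons τ s : Fin (w.length + 1) → ℝ) q ∈ O ∧
      Module.finrank ℝ (LinearMap.range (fderiv ℝ (fun s : Fin w.length → ℝ =>
        extChartAt (𝓡 n) x₀ (chronProduct W w s q)) s :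
          (Fin w.length → ℝ) →ₗ[ℝ] EuclideanSpace ℝ (Fin n))) <
      Module.finrank ℝ (LinearMap.range (fderiv ℝ (fun s : Fin (w.length + 1) → ℝ =>
        extChartAt (𝓡 n) x₀ (chronProduct W (a :: w) s q)) (Fin.cons τ s) :
          (Fin (w.length + 1) → ℝ) →ₗ[ℝ] EuclideanSpace ℝ (Fin n))) := by
  let F : (Fin (w.length + 1) → ℝ) → M := fun s => chronProduct W (a :: w) s q
  let G : (Fin (w.length + 1) → ℝ) → EuclideanSpace ℝ (Fin n) := fun s => extChartAt (𝓡 n) x₀ (F s)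
  let G₀ : (Fin w.length → ℝ) → EuclideanSpace ℝ (Fin n) := fun s =>
    extChartAt (𝓡 n) x₀ (chronProduct W w s q)
  have hFs : F (Fin.cons 0 s) = chronProduct W w s q := by
    simp [F, chronProduct, flow_zero (hc a)]
  have hF : ContMDiff 𝓘(ℝ, Fin (w.length + 1) → ℝ) (𝓡 n) 2 F :=
    contMDiff_chronProduct hW hc q (a :: w)
  have hG : ContDiffAt ℝ 2 G (Fin.cons 0 s) :=
    contDiffAt_extChartAt_comp (hF _) (by rw [hFs]; exact hOs hs)
  have hc1 : Differentiable ℝ (fun s' : Fin w.length → ℝ =>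
      (Fin.cons 0 s' : Fin (w.length + 1) → ℝ)) := by
    rw [differentiable_pi]
    refine Fin.cases ?_ fun i => ?_
    · simp
    · simpa using differentiable_apply i
  have hc2 : Differentiable ℝ (fun τ : ℝ => (Fin.cons τ s : Fin (w.length + 1) → ℝ)) := by
    rw [differentiable_pi]
    refine Fin.cases ?_ fun i => ?_
    · simp
    · simp
  have hG₀ : G₀ = fun s' => G (Fin.cons 0 s') := by
    funext s'
    simp [G, F, G₀, chronProduct, flow_zero (hc a)]
  have hle : LinearMap.range (fderiv ℝ G₀ s : (Fin w.length → ℝ) →ₗ[ℝ] EuclideanSpace ℝ (Fin n)) ≤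
      LinearMap.range (fderiv ℝ G (Fin.cons 0 s) :
        (Fin (w.length + 1) → ℝ) →ₗ[ℝ] EuclideanSpace ℝ (Fin n)) := by
    rw [hG₀]
    exact range_fderiv_comp_le (f := G)
      (g := fun s' : Fin w.length → ℝ => (Fin.cons 0 s' : Fin (w.length + 1) → ℝ))
      (hG.differentiableAt two_ne_zero) (hc1 s)
  have hmem : coordField (W a) x₀ (extChartAt (𝓡 n) x₀ (chronProduct W w s q)) ∈
      LinearMap.range (fderiv ℝ G (Fin.cons 0 s) :
        (Fin (w.length + 1) → ℝ) →ₗ[ℝ] EuclideanSpace ℝ (Fin n)) := by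
    have h1 : HasDerivAt (fun τ : ℝ => G (Fin.cons τ s))
        (coordField (W a) x₀ (extChartAt (𝓡 n) x₀ (chronProduct W w s q))) 0 := by
      have h2 := hasDerivAt_extChartAt (x₀ := x₀) (t := 0)
        (γ := fun τ => flow (W a) τ (chronProduct W w s q))
        (by simp only [flow_zero (hc a)]; exact hOs hs)
        (isMIntegralCurve_flow (hc a) (chronProduct W w s q) 0)
      simpa [flow_zero (hc a), G, F, chronProduct] using h2
    refine range_fderiv_comp_le (f := G)
      (g := fun τ : ℝ => (Fin.cons τ s : Fin (w.length + 1) → ℝ))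
      (hG.differentiableAt two_ne_zero) (hc2 0) ⟨1, ?_⟩
    have := h1.hasFDerivAt.fderiv
    rw [ContinuousLinearMap.coe_coe, this]
    simp
  have hlt : Module.finrank ℝ (LinearMap.range (fderiv ℝ G₀ s :
      (Fin w.length → ℝ) →ₗ[ℝ] EuclideanSpace ℝ (Fin n))) <
      Module.finrank ℝ (LinearMap.range (fderiv ℝ G (Fin.cons 0 s) :
        (Fin (w.length + 1) → ℝ) →ₗ[ℝ] EuclideanSpace ℝ (Fin n))) :=
    Submodule.finrank_lt_finrank_of_lt (lt_of_le_of_ne hle fun h => ha (h ▸ hmem))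
  have hev : ∀ᶠ s' in 𝓝 (Fin.cons 0 s : Fin (w.length + 1) → ℝ), F s' ∈ O ∧
      Module.finrank ℝ (LinearMap.range (fderiv ℝ G₀ s :
        (Fin w.length → ℝ) →ₗ[ℝ] EuclideanSpace ℝ (Fin n))) <
      Module.finrank ℝ (LinearMap.range (fderiv ℝ G s' :
        (Fin (w.length + 1) → ℝ) →ₗ[ℝ] EuclideanSpace ℝ (Fin n))) := by
    refine (hF.continuous.continuousAt.eventually_mem (hO.mem_nhds (by rw [hFs]; exact hs))).and ?_
    exact (hG.fderiv_right (m := 1) (by norm_num)).continuousAt.eventually_mem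
      ((isOpen_le_finrank_range _).mem_nhds hlt)
  have hev2 : ∀ᶠ τ : ℝ in 𝓝[>] 0, _ := nhdsWithin_le_nhds (hc2.continuous.tendsto 0 |>.eventually hev)
  obtain ⟨τ, hτ, hτpos⟩ := (hev2.and self_mem_nhdsWithin).exists
  exact ⟨τ, hτpos, hτ.1, hτ.2⟩

omit [T2Space M] in
/-- If fields are tangent to the image of an immersion `ψ` (in the chart around `x₀`), then so are
their iterated brackets. -/
lemma coordField_iterBracket_mem_range (hW : ∀ i, IsSmoothField (W i)) {V : Type*}
    [NormedAddCommGroup V] [NormedSpace ℝ V] [FiniteDimensional ℝ V] {x₀ : M}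
    {ψ : V → EuclideanSpace ℝ (Fin n)} {v₀ : V}
    (hψ : ∀ᶠ v in 𝓝 v₀, ContDiffAt ℝ 2 ψ v ∧ Function.Injective (fderiv ℝ ψ v) ∧
      ψ v ∈ (extChartAt (𝓡 n) x₀).target)
    (ht : ∀ i, ∀ᶠ v in 𝓝 v₀, coordField (W i) x₀ (ψ v) ∈
      LinearMap.range (fderiv ℝ ψ v : V →ₗ[ℝ] EuclideanSpace ℝ (Fin n))) :
    ∀ β : List ι, ∀ᶠ v in 𝓝 v₀, coordField (iterBracket W β) x₀ (ψ v) ∈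
      LinearMap.range (fderiv ℝ ψ v : V →ₗ[ℝ] EuclideanSpace ℝ (Fin n))
  | [] => Eventually.of_forall fun v => by
      have : coordField (iterBracket W []) x₀ (ψ v) = 0 := map_zero (mfderiv (𝓡 n)
        𝓘(ℝ, EuclideanSpace ℝ (Fin n)) (extChartAt (𝓡 n) x₀) ((extChartAt (𝓡 n) x₀).symm (ψ v)))
      rw [this]
      exact zero_mem _
  | [a] => ht a
  | a :: b :: l => by
    have hdiff : ∀ {X : (x : M) → TangentSpace (𝓡 n) x}, IsSmoothField X →
        ∀ {y}, y ∈ (extChartAt (𝓡 n) x₀).target → DifferentiableAt ℝ (coordField X x₀) y :=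
      fun hX y hy => ((contDiffOn_coordField hX x₀).contDiffAt
        ((isOpen_extChartAt_target x₀).mem_nhds hy)).differentiableAt (by simp)
    filter_upwards [hψ, (ht a).eventually_nhds,
      (coordField_iterBracket_mem_range hW hψ ht (b :: l)).eventually_nhds] with v hv h1 h2
    have hb := isSmoothField_iterBracket hW (b :: l)
    have := lieBracket_mem_range_fderiv hv.1 hv.2.1 (hdiff (hW a) hv.2.2) (hdiff hb hv.2.2) h1 h2
    rw [← coordField_mlieBracket (hW a) hb x₀ hv.2.2] at this
    exact this

end ChronologicalProducts

/-! ### Existence of general points -/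

section FullRank

variable {n : ℕ} {M : Type*} [TopologicalSpace M] [T2Space M]
  [ChartedSpace (EuclideanSpace ℝ (Fin n)) M] [IsManifold (𝓡 n) ∞ M]
  {ι : Type*} {W : ι → (x : M) → TangentSpace (𝓡 n) x}

omit [T2Space M] in
lemma IsGeneratingAt.eventually_span_coordField (hW : ∀ i, IsSmoothField (W i))
    {B : Finset (List ι)} {q : M} (hB : IsGeneratingAt W B q) :
    ∀ᶠ y in 𝓝 (extChartAt (𝓡 n) q q),
      Submodule.span ℝ {v | ∃ β ∈ B, v = coordField (iterBracket W β) q y} = ⊤ := by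
  refine eventually_span_eq_top B (Z := fun β => coordField (iterBracket W β) q)
    (fun β _ => ((contDiffOn_coordField (isSmoothField_iterBracket hW β) q).contDiffAt
      (extChartAt_target_mem_nhds q)).continuousAt) ?_
  have hq : q ∈ (extChartAt (𝓡 n) q).source := mem_extChartAt_source q
  let A : TangentSpace (𝓡 n) q →ₗ[ℝ] EuclideanSpace ℝ (Fin n) :=
    (mfderiv (𝓡 n) 𝓘(ℝ, EuclideanSpace ℝ (Fin n)) (extChartAt (𝓡 n) q) q).toLinearMap
  have hA : Function.Surjective A :=
    Function.RightInverse.surjective (fun v => DFunLike.congr_fun (mfderiv_extChartAt_comp_symm hq) v)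
  have h := congrArg (Submodule.map A) hB.2
  rw [Submodule.map_top, LinearMap.range_eq_top.2 hA, Submodule.map_span] at h
  rw [← h]
  congr 1
  ext v
  constructor
  · rintro ⟨β, hβ, rfl⟩
    exact ⟨_, ⟨β, hβ, rfl⟩, (coordField_extChartAt _ hq).symm⟩
  · rintro ⟨_, ⟨β, hβ, rfl⟩, rfl⟩
    exact ⟨β, hβ, (coordField_extChartAt _ hq).symm⟩

/-- Under the bracket generating condition some chronological product with positive times has a
derivative that is onto. Take a product of maximal rank among those ending near `q`: all fields are
tangent to its image, hence so are their iterated brackets, and these span. -/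
theorem IsGeneratingAt.exists_regularPoints_nonempty (hW : ∀ i, IsSmoothField (W i))
    (hc : ∀ i, IsCompleteField (W i)) {B : Finset (List ι)} {q : M} (hB : IsGeneratingAt W B q) :
    ∃ w : List ι, (regularPoints W w q).Nonempty := by
  set φ := extChartAt (𝓡 n) q with hφ
  obtain ⟨S, hS, hSo, hqS⟩ := eventually_nhds_iff.1 (hB.eventually_span_coordField hW)
  let O : Set M := φ.source ∩ φ ⁻¹' S
  have hO : IsOpen O :=
    (continuousOn_extChartAt q).isOpen_inter_preimage (isOpen_extChartAt_source q) hSo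
  have hOs : O ⊆ φ.source := inter_subset_left
  have hqO : q ∈ O := ⟨mem_extChartAt_source q, hqS⟩
  let G : (w : List ι) → (Fin w.length → ℝ) → EuclideanSpace ℝ (Fin n) := fun w t =>
    φ (chronProduct W w t q)
  let rk : (w : List ι) → (Fin w.length → ℝ) → ℕ := fun w t =>
    Module.finrank ℝ (LinearMap.range (fderiv ℝ (G w) t :
      (Fin w.length → ℝ) →ₗ[ℝ] EuclideanSpace ℝ (Fin n)))
  let R : Set ℕ := {k | ∃ (w : List ι) (t : Fin w.length → ℝ), (∀ i, 0 < t i) ∧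
    chronProduct W w t q ∈ O ∧ rk w t = k}
  have hRne : R.Nonempty := ⟨_, [], Fin.elim0, fun i => i.elim0, hqO, rfl⟩
  have hRbdd : BddAbove R := by
    refine ⟨Module.finrank ℝ (EuclideanSpace ℝ (Fin n)), ?_⟩
    rintro _ ⟨w, t, -, -, rfl⟩
    exact Submodule.finrank_le _
  obtain ⟨w, t, htpos, htO, htk⟩ := Nat.sSup_mem hRne hRbdd
  have hmax : ∀ (w' : List ι) (t' : Fin w'.length → ℝ), (∀ i, 0 < t' i) →
      chronProduct W w' t' q ∈ O → rk w' t' ≤ rk w t := fun w' t' h1 h2 =>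
    htk ▸ le_csSup hRbdd ⟨w', t', h1, h2, rfl⟩
  have hF := contMDiff_chronProduct hW hc q w
  have hGc : ∀ s, chronProduct W w s q ∈ O → ContDiffAt ℝ 2 (G w) s := fun s hs =>
    contDiffAt_extChartAt_comp (hF s) (hOs hs)
  have hev : ∀ᶠ s in 𝓝 t, (∀ i, 0 < s i) ∧ chronProduct W w s q ∈ O ∧ rk w t ≤ rk w s := by
    refine (eventually_all.2 fun i => ?_).and ((hF.continuous.continuousAt.eventually_mem
      (hO.mem_nhds htO)).and ?_)
    · exact (continuous_apply i).continuousAt.eventually_mem (Ioi_mem_nhds (htpos i))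
    · exact ((hGc t htO).fderiv_right (m := 1) (by norm_num)).continuousAt.eventually_mem
        ((isOpen_le_finrank_range (rk w t)).mem_nhds (le_refl (rk w t)))
  -- by maximality of the rank all fields are tangent to the image near `t`
  have htan : ∀ a, ∀ᶠ s in 𝓝 t, coordField (W a) q (G w s) ∈
      LinearMap.range (fderiv ℝ (G w) s :
        (Fin w.length → ℝ) →ₗ[ℝ] EuclideanSpace ℝ (Fin n)) := by
    intro a
    filter_upwards [hev] with s ⟨hspos, hsO, hsk⟩
    by_contra hcon
    obtain ⟨τ, hτ, hτO, hτk⟩ := exists_pos_finrank_lt hW hc hO hOs hsO hcon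
    exact absurd (hmax (a :: w) (Fin.cons τ s : Fin (w.length + 1) → ℝ)
      (Fin.cases (by simpa using hτ) (by simpa using hspos)) hτO)
      (not_le.2 (hsk.trans_lt hτk))
  -- restrict to a complement of the kernel to obtain an immersion with the same tangent spaces
  let D : (Fin w.length → ℝ) →ₗ[ℝ] EuclideanSpace ℝ (Fin n) := fderiv ℝ (G w) t
  obtain ⟨L, hL⟩ := Submodule.exists_isCompl (LinearMap.ker D)
  have hLk : Module.finrank ℝ L = rk w t := by
    have h1 := Submodule.finrank_add_eq_of_isCompl hL
    have h2 := LinearMap.finrank_range_add_finrank_ker D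
    change _ = Module.finrank ℝ (LinearMap.range D)
    omega
  let j : L → (Fin w.length → ℝ) := fun v => t + v
  have hj : Continuous j := by fun_prop
  have hjd : ∀ v, HasFDerivAt j L.subtypeL v := fun v => L.subtypeL.hasFDerivAt.const_add t
  have hj0 : j 0 = t := by simp [j]
  let ψ : L → EuclideanSpace ℝ (Fin n) := fun v => G w (j v)
  have hjt : Tendsto j (𝓝 0) (𝓝 t) := by
    have := hj.tendsto 0
    rwa [hj0] at this
  have hψc : ∀ v, chronProduct W w (j v) q ∈ O → ContDiffAt ℝ 2 ψ v := fun v hv =>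
    ContDiffAt.comp v (g := G w) (f := j) (hGc (j v) hv)
      (contDiffAt_const.add L.subtypeL.contDiff.contDiffAt)
  have hψd : ∀ v, chronProduct W w (j v) q ∈ O →
      fderiv ℝ ψ v = (fderiv ℝ (G w) (j v)).comp L.subtypeL := fun v hv =>
    (((hGc (j v) hv).differentiableAt two_ne_zero).hasFDerivAt.comp v (hjd v)).fderiv
  have h0O : chronProduct W w (j 0) q ∈ O := by rw [hj0]; exact htO
  have hinj0 : Function.Injective (fderiv ℝ ψ 0) := by
    rw [hψd 0 h0O, hj0, injective_iff_map_eq_zero]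
    intro v hv
    have h1 : (v : Fin w.length → ℝ) ∈ LinearMap.ker D ⊓ L := ⟨hv, v.2⟩
    rw [hL.inf_eq_bot] at h1
    exact Subtype.ext h1
  have hrank0 : Module.finrank ℝ L ≤ Module.finrank ℝ (LinearMap.range
      (fderiv ℝ ψ 0 : L →ₗ[ℝ] EuclideanSpace ℝ (Fin n))) :=
    (LinearMap.finrank_range_of_inj hinj0).ge
  have hev2 : ∀ᶠ v in 𝓝 (0 : L), chronProduct W w (j v) q ∈ O ∧ rk w (j v) = Module.finrank ℝ L ∧
      Module.finrank ℝ L ≤ Module.finrank ℝ (LinearMap.range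
        (fderiv ℝ ψ v : L →ₗ[ℝ] EuclideanSpace ℝ (Fin n))) := by
    filter_upwards [hjt.eventually hev, ((hψc 0 h0O).fderiv_right (m := 1)
      (by norm_num)).continuousAt.eventually_mem
        ((isOpen_le_finrank_range _).mem_nhds hrank0)] with v h1 h2
    exact ⟨h1.2.1, hLk ▸ le_antisymm (hmax _ _ h1.1 h1.2.1) h1.2.2, h2⟩
  have hψ : ∀ᶠ v in 𝓝 (0 : L), ContDiffAt ℝ 2 ψ v ∧ Function.Injective (fderiv ℝ ψ v) ∧
      ψ v ∈ φ.target := by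
    filter_upwards [hev2] with v hv
    refine ⟨hψc v hv.1, ?_, φ.map_source (hOs hv.1)⟩
    have h2 := LinearMap.finrank_range_add_finrank_ker
      (fderiv ℝ ψ v : L →ₗ[ℝ] EuclideanSpace ℝ (Fin n))
    exact LinearMap.ker_eq_bot.1 (Submodule.finrank_eq_zero.1 (by omega))
  have hψt : ∀ a, ∀ᶠ v in 𝓝 (0 : L), coordField (W a) q (ψ v) ∈
      LinearMap.range (fderiv ℝ ψ v : L →ₗ[ℝ] EuclideanSpace ℝ (Fin n)) := by
    intro a
    filter_upwards [hev2, hjt.eventually (htan a)] with v hv h1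
    have hle : LinearMap.range (fderiv ℝ ψ v : L →ₗ[ℝ] EuclideanSpace ℝ (Fin n)) ≤
        LinearMap.range (fderiv ℝ (G w) (j v) :
          (Fin w.length → ℝ) →ₗ[ℝ] EuclideanSpace ℝ (Fin n)) := by
      rw [hψd v hv.1]
      exact LinearMap.range_comp_le_range _ _
    rw [Submodule.eq_of_le_of_finrank_le hle (hv.2.1.trans_le hv.2.2)]
    exact h1
  have hbr := coordField_iterBracket_mem_range hW hψ hψt
  have htop : LinearMap.range (fderiv ℝ ψ 0 : L →ₗ[ℝ] EuclideanSpace ℝ (Fin n)) = ⊤ := by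
    rw [← top_le_iff, ← hS (ψ 0) h0O.2, Submodule.span_le]
    rintro _ ⟨β, -, rfl⟩
    exact (hbr β).self_of_nhds
  have hsurj : Function.Surjective (fderiv ℝ (G w) t) := by
    have h1 := LinearMap.range_eq_top.1 htop
    rw [hψd 0 h0O, hj0] at h1
    exact Function.Surjective.of_comp (f := fderiv ℝ (G w) t) (g := L.subtypeL) h1
  refine ⟨w, _, t, htpos, ?_, rfl⟩
  exact not_not.2 ((surjective_mfderiv_iff ((hF t).mdifferentiableAt (by simp)) (hOs htO)).2 hsurj)

/-- The concatenation of all monomials of `B`, followed by an arbitrary word, is a general word. -/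
lemma exists_isGeneralWord_append {B : Finset (List ι)} (hB : ∀ i, [i] ∈ B) (w : List ι) :
    ∃ m : List ι, IsGeneralWord B (m ++ w) := by
  refine ⟨(B.toList.flatMap bracketMonomials).flatten,
    B.toList.flatMap bracketMonomials ++ w.map fun a => [a], ?_, ?_, ?_⟩
  · rw [List.flatten_append]
    congr 1
    induction w with
    | nil => rfl
    | cons a w ih => simpa using ih
  · intro m hm
    rw [List.mem_append, List.mem_flatMap, List.mem_map] at hm
    rcases hm with ⟨β, hβ, hm⟩ | ⟨a, -, rfl⟩
    · exact ⟨β, by simpa using hβ, hm⟩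
    · exact ⟨[a], hB a, by simp [bracketMonomials]⟩
  · intro β hβ m hm
    exact List.mem_append_left _ (List.mem_flatMap.2 ⟨β, by simpa using hβ, hm⟩)

theorem IsGeneratingAt.generalPoints_nonempty (hW : ∀ i, IsSmoothField (W i))
    (hc : ∀ i, IsCompleteField (W i)) {B : Finset (List ι)} {q : M} (hB : IsGeneratingAt W B q) :
    (generalPoints W B q).Nonempty := by
  obtain ⟨w, hw⟩ := hB.exists_regularPoints_nonempty hW hc
  obtain ⟨m, hm⟩ := exists_isGeneralWord_append hB.1 w
  obtain ⟨p, hp⟩ := regularPoints_append_nonempty hW hc hw m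
  exact ⟨p, m ++ w, hm, hp⟩

lemma isOpen_generalPoints (hW : ∀ i, IsSmoothField (W i)) (hc : ∀ i, IsCompleteField (W i))
    (B : Finset (List ι)) (q : M) : IsOpen (generalPoints W B q) := by
  have : generalPoints W B q = ⋃ w ∈ {w | IsGeneralWord B w}, regularPoints W w q := by
    ext p; simp [generalPoints]
  rw [this]
  exact isOpen_biUnion fun w _ => isOpen_regularPoints hW hc q w

end FullRank

/-! ### Absolutely continuous curves -/

section AbsolutelyContinuous

open AbsolutelyContinuousOnInterval

variable {X Y F : Type*} [PseudoMetricSpace X] [PseudoMetricSpace Y]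
  [NormedAddCommGroup F] {a b c d : ℝ}

/-- A curve whose increments are dominated by those of an absolutely continuous curve is absolutely
continuous. -/
theorem absolutelyContinuousOnInterval_of_dist_le {f : ℝ → X} {g : ℝ → Y}
    (hg : AbsolutelyContinuousOnInterval g a b) (C : ℝ)
    (h : ∀ x ∈ uIcc a b, ∀ y ∈ uIcc a b, dist (f x) (f y) ≤ C * dist (g x) (g y)) :
    AbsolutelyContinuousOnInterval f a b := by
  have hlim : Tendsto (fun E : ℕ × (ℕ → ℝ × ℝ) =>
      C * ∑ i ∈ Finset.range E.1, dist (g (E.2 i).1) (g (E.2 i).2))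
      (totalLengthFilter ⊓ 𝓟 (disjWithin a b)) (𝓝 0) := by
    have := (show Tendsto _ _ _ from hg).const_mul C
    rwa [mul_zero] at this
  refine squeeze_zero' (Eventually.of_forall fun E => Finset.sum_nonneg fun _ _ => dist_nonneg) ?_
    hlim
  have : ∀ᶠ E in totalLengthFilter ⊓ 𝓟 (disjWithin a b), E ∈ disjWithin a b :=
    eventually_inf_principal.2 (Eventually.of_forall fun _ h => h)
  filter_upwards [this] with E hE
  rw [Finset.mul_sum]
  exact Finset.sum_le_sum fun i hi => h _ (hE.1 i hi).1 _ (hE.1 i hi).2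

/-- Monotone changes of time that do not increase lengths preserve absolute continuity. -/
theorem absolutelyContinuousOnInterval_comp_monotone {f : ℝ → X} {φ : ℝ → ℝ}
    (hf : AbsolutelyContinuousOnInterval f a b) (hφ : Monotone φ) (hφ' : LipschitzWith 1 φ)
    (hmaps : MapsTo φ (uIcc c d) (uIcc a b)) :
    AbsolutelyContinuousOnInterval (fun t => f (φ t)) c d := by
  rw [absolutelyContinuousOnInterval_iff] at hf ⊢
  intro ε hε
  obtain ⟨δ, hδ, H⟩ := hf ε hε
  refine ⟨δ, hδ, fun E hE hlen => ?_⟩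
  refine H (E.1, fun i => (φ (E.2 i).1, φ (E.2 i).2)) ⟨fun i hi => ?_, ?_⟩ ?_
  · exact ⟨hmaps (hE.1 i hi).1, hmaps (hE.1 i hi).2⟩
  · intro i hi j hj hij
    have hd := hE.2 hi hj hij
    simp only [Function.onFun] at hd ⊢
    rw [Set.disjoint_left]
    intro z hz hz'
    simp only [uIoc, mem_Ioc, ← hφ.map_min, ← hφ.map_max] at hz hz'
    rw [Set.uIoc, Set.uIoc, Set.Ioc_disjoint_Ioc] at hd
    have h1 : φ (max (min (E.2 i).1 (E.2 i).2) (min (E.2 j).1 (E.2 j).2)) < z := by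
      rw [hφ.map_max]; exact max_lt hz.1 hz'.1
    have h2 : z ≤ φ (min (max (E.2 i).1 (E.2 i).2) (max (E.2 j).1 (E.2 j).2)) := by
      rw [hφ.map_min (a := max _ _)]; exact le_min hz.2 hz'.2
    exact absurd (h1.trans_le (h2.trans (hφ hd))) (lt_irrefl _)
  · refine lt_of_le_of_lt (Finset.sum_le_sum fun i _ => ?_) hlen
    simpa using hφ'.dist_le_mul (E.2 i).1 (E.2 i).2

/-- Absolute continuity on two adjacent intervals gives absolute continuity on their union. -/
theorem absolutelyContinuousOnInterval_trans {f : ℝ → F} (hab : a ≤ b) (hbc : b ≤ c)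
    (h₁ : AbsolutelyContinuousOnInterval f a b) (h₂ : AbsolutelyContinuousOnInterval f b c) :
    AbsolutelyContinuousOnInterval f a c := by
  -- `f t = f (min t b) + f (max t b) - f b`
  have e₁ : AbsolutelyContinuousOnInterval (fun t => f (min t b)) a c := by
    refine absolutelyContinuousOnInterval_comp_monotone h₁ (fun x y h => min_le_min_right b h) ?_ ?_
    · exact LipschitzWith.id.min_const b
    · intro t ht
      rw [uIcc_of_le (hab.trans hbc)] at ht
      rw [uIcc_of_le hab]
      exact ⟨le_min ht.1 hab, min_le_right _ _⟩
  have e₂ : AbsolutelyContinuousOnInterval (fun t => f (max t b)) a c := by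
    refine absolutelyContinuousOnInterval_comp_monotone h₂ (fun x y h => max_le_max_right b h) ?_ ?_
    · exact LipschitzWith.id.max_const b
    · intro t ht
      rw [uIcc_of_le (hab.trans hbc)] at ht
      rw [uIcc_of_le hbc]
      exact ⟨le_max_right _ _, max_le ht.2 hbc⟩
  have e₃ : AbsolutelyContinuousOnInterval (fun _ : ℝ => f b) a c :=
    (LipschitzWith.const (f b)).lipschitzOnWith.absolutelyContinuousOnInterval
  have e := (e₁.add e₂).sub e₃
  convert! e using 1
  ext t
  rcases le_total t b with h | h <;> simp [h]

theorem _root_.MeasureTheory.LocallyIntegrable.intervalIntegrable {g : ℝ → F}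
    (hg : LocallyIntegrable g volume) (a b : ℝ) : IntervalIntegrable g volume a b :=
  intervalIntegrable_iff.mpr
    ((hg.integrableOn_isCompact isCompact_uIcc).mono_set uIoc_subset_uIcc)

theorem absolutelyContinuousOnInterval_integral [NormedSpace ℝ F] {f : ℝ → F}
    (hf : LocallyIntegrable f volume) (s a b : ℝ) :
    AbsolutelyContinuousOnInterval (fun t => ∫ v in s..t, f v) a b := by
  have hi : ∀ x y, IntervalIntegrable f volume x y := hf.intervalIntegrable
  refine absolutelyContinuousOnInterval_of_dist_le
    ((hi a b).norm.absolutelyContinuousOnInterval_intervalIntegral left_mem_uIcc) 1 ?_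
  intro x _ y _
  rw [one_mul, dist_comm, dist_comm (∫ v in a..x, ‖f v‖), dist_eq_norm, dist_eq_norm,
    intervalIntegral.integral_interval_sub_left (hi _ _) (hi _ _),
    intervalIntegral.integral_interval_sub_left (hi _ _).norm (hi _ _).norm]
  exact intervalIntegral.norm_integral_le_abs_integral_norm

/-- The composition of a `C¹` map with an absolutely continuous curve is absolutely continuous. -/
theorem absolutelyContinuousOnInterval_comp_contDiffOn {E : Type*} [NormedAddCommGroup E]
    [NormedSpace ℝ E] [NormedSpace ℝ F] {s : Set E} (hs : IsOpen s) {g : E → F}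
    (hg : ContDiffOn ℝ 1 g s) {f : ℝ → E} (hf : AbsolutelyContinuousOnInterval f a b)
    (hfs : MapsTo f (uIcc a b) s) : AbsolutelyContinuousOnInterval (fun t => g (f t)) a b := by
  have hK : IsCompact (f '' uIcc a b) := isCompact_uIcc.image_of_continuousOn hf.continuousOn
  have hL : LocallyLipschitzOn (f '' uIcc a b) g := by
    rintro _ ⟨t, ht, rfl⟩
    obtain ⟨C, u, hu, hC⟩ :=
      (hg.contDiffAt (hs.mem_nhds (hfs ht))).exists_lipschitzOnWith
    exact ⟨C, u, mem_nhdsWithin_of_mem_nhds hu, hC⟩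
  obtain ⟨C, hC⟩ := hL.exists_lipschitzOnWith_of_compact hK
  exact absolutelyContinuousOnInterval_of_dist_le hf C fun x hx y hy =>
    hC.dist_le_mul _ (mem_image_of_mem f hx) _ (mem_image_of_mem f hy)

end AbsolutelyContinuous

/-! ### Carathéodory differential equations -/

section Caratheodory

variable {E : Type*} [NormedAddCommGroup E]

/-- The Carathéodory conditions on a set `K`: measurability in time, and for almost every time a
bound `m t` both for the norm and for the Lipschitz constant on `K`. -/
structure IsCaratheodory (f : ℝ → E → E) (m : ℝ → ℝ) (K : Set E) : Prop where
  aestronglyMeasurable : ∀ y ∈ K, AEStronglyMeasurable (fun t => f t y) volume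
  locallyIntegrable : LocallyIntegrable m volume
  bound : ∀ᵐ t : ℝ, (∀ y ∈ K, ‖f t y‖ ≤ m t) ∧
    ∀ y ∈ K, ∀ z ∈ K, ‖f t y - f t z‖ ≤ m t * ‖y - z‖

variable {f : ℝ → E → E} {m : ℝ → ℝ} {K : Set E}

/-- Superposition with a continuous curve keeps measurability: the curve is a limit of simple
functions with values in `K`. -/
theorem IsCaratheodory.aestronglyMeasurable_comp [SecondCountableTopology E]
    (hf : IsCaratheodory f m K) {α : ℝ → E} (hα : Continuous α) (hαK : ∀ t, α t ∈ K) :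
    AEStronglyMeasurable (fun t => f t (α t)) volume := by
  borelize E
  let S : ℕ → SimpleFunc ℝ E := SimpleFunc.approxOn α hα.measurable K (α 0) (hαK 0)
  have hSK : ∀ k t, S k t ∈ K := fun k t => SimpleFunc.approxOn_mem _ _ k t
  have hS : ∀ t, Tendsto (fun k => S k t) atTop (𝓝 (α t)) := fun t =>
    SimpleFunc.tendsto_approxOn _ _ (subset_closure (hαK t))
  refine aestronglyMeasurable_of_tendsto_ae atTop (f := fun k t => f t (S k t)) (fun k => ?_) ?_
  · have e : (fun t => f t (S k t)) =
        fun t => ∑ y ∈ (S k).range, (S k ⁻¹' {y}).indicator (fun t => f t y) t := by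
      ext t
      rw [Finset.sum_eq_single (S k t)]
      · rw [indicator_of_mem (by simp)]
      · intro y _ hy
        exact indicator_of_notMem (fun h => hy (by simpa using h.symm)) _
      · intro h
        exact absurd ((S k).mem_range_self t) h
    rw [e]
    refine Finset.aestronglyMeasurable_fun_sum _ fun y hy => ?_
    obtain ⟨t, rfl⟩ := SimpleFunc.mem_range.1 hy
    exact (hf.aestronglyMeasurable _ (hSK k t)).indicator ((S k).measurableSet_fiber _)
  · filter_upwards [hf.bound] with t ht
    rw [tendsto_iff_norm_sub_tendsto_zero]
    have : Tendsto (fun k => m t * ‖S k t - α t‖) atTop (𝓝 0) := by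
      simpa using (tendsto_iff_norm_sub_tendsto_zero.1 (hS t)).const_mul (m t)
    exact squeeze_zero (fun _ => norm_nonneg _) (fun k => ht.2 _ (hSK k t) _ (hαK t)) this

theorem IsCaratheodory.locallyIntegrable_comp [SecondCountableTopology E]
    (hf : IsCaratheodory f m K) {α : ℝ → E} (hα : Continuous α) (hαK : ∀ t, α t ∈ K) :
    LocallyIntegrable (fun t => f t (α t)) volume :=
  hf.locallyIntegrable.mono (hf.aestronglyMeasurable_comp hα hαK)
    (hf.bound.mono fun t ht => (ht.1 _ (hαK t)).trans (le_abs_self _))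

variable [NormedSpace ℝ E]

/-- The integral over a subinterval is bounded by the integral of a bound over the whole
interval. -/
theorem norm_integral_le_integral_of_mem {g : ℝ → E} {h : ℝ → ℝ} {s₁ s₂ t : ℝ}
    (hh : LocallyIntegrable h volume) (hgh : ∀ᵐ s : ℝ, ‖g s‖ ≤ h s) (ht : t ∈ Icc s₁ s₂) :
    ‖∫ s in s₂..t, g s‖ ≤ ∫ s in s₁..s₂, h s := by
  have h0 : 0 ≤ᵐ[volume] h := hgh.mono fun s hs => (norm_nonneg _).trans hs
  rw [intervalIntegral.integral_symm, norm_neg]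
  calc ‖∫ s in t..s₂, g s‖ ≤ ∫ s in t..s₂, h s :=
        intervalIntegral.norm_integral_le_of_norm_le ht.2 (hgh.mono fun s hs _ => hs)
          (hh.intervalIntegrable _ _)
    _ ≤ ∫ s in s₁..s₂, h s :=
        intervalIntegral.integral_mono_interval ht.1 ht.2 le_rfl (ae_restrict_of_ae h0)
          (hh.intervalIntegrable _ _)

/-- The Picard integrals of two curves at distance at most `D` differ at most by `D / 2`, if the
Lipschitz constants have integral at most `1 / 2`. -/
theorem IsCaratheodory.norm_integral_sub_le [SecondCountableTopology E]
    (hf : IsCaratheodory f m K) {α β : ℝ → E} (hα : Continuous α) (hαK : ∀ t, α t ∈ K)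
    (hβ : Continuous β) (hβK : ∀ t, β t ∈ K) {D : ℝ} (hD : ∀ t, ‖α t - β t‖ ≤ D)
    {s₁ s₂ t : ℝ} (ht : t ∈ Icc s₁ s₂) (hm : ∫ s in s₁..s₂, m s ≤ 1 / 2) :
    ‖(∫ s in s₂..t, f s (α s)) - ∫ s in s₂..t, f s (β s)‖ ≤ 1 / 2 * D := by
  have hD0 : 0 ≤ D := (norm_nonneg _).trans (hD 0)
  rw [← intervalIntegral.integral_sub ((hf.locallyIntegrable_comp hα hαK).intervalIntegrable _ _)
    ((hf.locallyIntegrable_comp hβ hβK).intervalIntegrable _ _)]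
  refine (norm_integral_le_integral_of_mem (h := fun s => m s * D) (s₁ := s₁) ?_ ?_ ht).trans ?_
  · simpa only [Pi.smul_def, smul_eq_mul, mul_comm] using hf.locallyIntegrable.smul D
  · filter_upwards [hf.bound] with s hs
    have hm0 : 0 ≤ m s := (norm_nonneg _).trans (hs.1 _ (hαK s))
    exact (hs.2 _ (hαK s) _ (hβK s)).trans (by gcongr; exact hD s)
  · rw [intervalIntegral.integral_mul_const]
    gcongr

/-- Local existence for Carathéodory equations, solved backward from the time `s₂`: the Picard
operator is a contraction of the curves with values in the ball. -/
theorem IsCaratheodory.exists_solution [SecondCountableTopology E] [CompleteSpace E] {y₀ z : E}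
    {r : ℝ} (hf : IsCaratheodory f m (Metric.closedBall y₀ r)) {s₁ s₂ : ℝ} (h12 : s₁ ≤ s₂)
    (hm : ∫ s in s₁..s₂, m s ≤ 1 / 2) (hm' : ∫ s in s₁..s₂, m s ≤ r / 2)
    (hz : ‖z - y₀‖ ≤ r / 2) :
    ∃ α : ℝ → E, Continuous α ∧ (∀ t, α t ∈ Metric.closedBall y₀ r) ∧
      ∀ t ∈ Icc s₁ s₂, α t = z + ∫ s in s₂..t, f s (α s) := by
  have hr : 0 ≤ r := by linarith [norm_nonneg (z - y₀)]
  let S : Set C(Icc s₁ s₂, E) := {α | ∀ t, α t ∈ Metric.closedBall y₀ r}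
  have hS : IsClosed S := by
    simp only [S, ofPred_forall]
    exact isClosed_iInter fun t =>
      Metric.isClosed_closedBall.preimage (ContinuousEvalConst.continuous_eval_const t)
  let ext : C(Icc s₁ s₂, E) → ℝ → E := fun α t => α (projIcc s₁ s₂ h12 t)
  have hext : ∀ α, Continuous (ext α) := fun α => α.continuous.comp continuous_projIcc
  have hextS : ∀ α : S, ∀ t, ext α t ∈ Metric.closedBall y₀ r := fun α t => α.2 _
  have hli : ∀ α : S, LocallyIntegrable (fun s => f s (ext α s)) volume := fun α =>
    hf.locallyIntegrable_comp (hext α) (hextS α)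
  let T : S → C(Icc s₁ s₂, E) := fun α =>
    ⟨fun t => z + ∫ s in s₂..(t : ℝ), f s (ext α s), by
      refine continuous_const.add ?_
      exact (intervalIntegral.continuous_primitive
        (fun a b => (hli α).intervalIntegrable a b) s₂).comp continuous_subtype_val⟩
  have hT : ∀ α, T α ∈ S := by
    intro α t
    have h1 : ‖∫ s in s₂..(t : ℝ), f s (ext α s)‖ ≤ r / 2 := by
      refine (norm_integral_le_integral_of_mem hf.locallyIntegrable ?_ t.2).trans hm'
      exact hf.bound.mono fun s hs => hs.1 _ (hextS α s)
    rw [mem_closedBall_iff_norm]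
    calc ‖z + (∫ s in s₂..(t : ℝ), f s (ext α s)) - y₀‖
        = ‖(z - y₀) + ∫ s in s₂..(t : ℝ), f s (ext α s)‖ := by congr 1; abel
      _ ≤ r := (norm_add_le _ _).trans (by linarith)
  let T' : S → S := fun α => ⟨T α, hT α⟩
  have hcontr : ContractingWith (1 / 2) T' := by
    refine ⟨by norm_num, LipschitzWith.of_dist_le_mul fun α β => ?_⟩
    have hhalf : ((1 / 2 : NNReal) : ℝ) = 1 / 2 := by norm_num
    rw [Subtype.dist_eq, Subtype.dist_eq, hhalf, ContinuousMap.dist_le (by positivity)]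
    intro t
    have := hf.norm_integral_sub_le (hext α) (hextS α) (hext β) (hextS β)
      (D := dist (α : C(Icc s₁ s₂, E)) β)
      (fun s => by rw [← dist_eq_norm]; exact ContinuousMap.dist_apply_le_dist _) t.2 hm
    rw [dist_eq_norm]
    simpa [T', T] using this
  have : CompleteSpace S := hS.completeSpace_coe
  have : Nonempty S := ⟨⟨ContinuousMap.const _ y₀, fun t => by simpa using hr⟩⟩
  let α := ContractingWith.fixedPoint T' hcontr
  have hα : T' α = α := hcontr.fixedPoint_isFixedPt
  refine ⟨ext α, hext α, hextS α, fun t ht => ?_⟩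
  have h1 : (α : C(Icc s₁ s₂, E)) ⟨t, ht⟩ = z + ∫ s in s₂..t, f s (ext α s) := by
    conv_lhs => rw [← hα]
    rfl
  simp only [ext, projIcc_of_mem h12 ht]
  exact h1

/-- An absolutely continuous solution of the differential equation solves the integral equation. -/
theorem IsCaratheodory.eq_add_integral [SecondCountableTopology E] [CompleteSpace E]
    (hf : IsCaratheodory f m K) {y β : ℝ → E} {s₁ s₂ : ℝ} (h12 : s₁ ≤ s₂)
    (hy : AbsolutelyContinuousOnInterval y s₁ s₂)
    (hy' : ∀ᵐ t : ℝ, t ∈ Icc s₁ s₂ → HasDerivAt y (f t (y t)) t)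
    (hβ : Continuous β) (hβK : ∀ t, β t ∈ K) (hyβ : EqOn y β (Icc s₁ s₂)) :
    ∀ t ∈ Icc s₁ s₂, y t = y s₂ + ∫ s in s₂..t, f s (β s) := by
  have hli := hf.locallyIntegrable_comp hβ hβK
  have hac := hy.sub (absolutelyContinuousOnInterval_integral hli s₂ s₁ s₂)
  obtain ⟨C, hC⟩ := hac.const_of_ae_hasDerivAt_zero (by
    filter_upwards [hy', _root_.LocallyIntegrable.ae_hasDerivAt_integral hli] with t h1 h2 ht
    rw [uIcc_of_le h12] at ht
    have h3 := (h1 ht).sub (h2 s₂)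
    rwa [hyβ ht, sub_self] at h3)
  rw [uIcc_of_le h12] at hC
  intro t ht
  have e1 := hC t ht
  have e2 := hC s₂ (right_mem_Icc.2 h12)
  simp only [Pi.sub_apply, intervalIntegral.integral_same, sub_zero] at e1 e2
  rw [e2, ← e1]
  abel

/-- Given a solution `y`, there is a backward solution from every point `z` near `y s₂`, and it stays
close to `y`. -/
theorem IsCaratheodory.exists_solution_near [SecondCountableTopology E] [CompleteSpace E]
    {y₀ z : E} {r : ℝ} (hf : IsCaratheodory f m (Metric.closedBall y₀ r)) {s₁ s₂ : ℝ}
    (h12 : s₁ ≤ s₂) (hm : ∫ s in s₁..s₂, m s ≤ 1 / 2) (hm' : ∫ s in s₁..s₂, m s ≤ r / 2)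
    (hz : ‖z - y₀‖ ≤ r / 2) {y : ℝ → E} (hy : AbsolutelyContinuousOnInterval y s₁ s₂)
    (hy' : ∀ᵐ t : ℝ, t ∈ Icc s₁ s₂ → HasDerivAt y (f t (y t)) t)
    (hyK : ∀ t ∈ Icc s₁ s₂, y t ∈ Metric.closedBall y₀ r) :
    ∃ α : ℝ → E, (∀ t ∈ Icc s₁ s₂, α t ∈ Metric.closedBall y₀ r) ∧ α s₂ = z ∧
      AbsolutelyContinuousOnInterval α s₁ s₂ ∧
      (∀ᵐ t : ℝ, t ∈ Icc s₁ s₂ → HasDerivAt α (f t (α t)) t) ∧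
      ‖α s₁ - y s₁‖ ≤ 2 * ‖z - y s₂‖ := by
  obtain ⟨α, hαc, hαK, hα⟩ := hf.exists_solution h12 hm hm' hz
  have hli := hf.locallyIntegrable_comp hαc hαK
  have hs1 : s₁ ∈ Icc s₁ s₂ := left_mem_Icc.2 h12
  have hs2 : s₂ ∈ Icc s₁ s₂ := right_mem_Icc.2 h12
  refine ⟨α, fun t _ => hαK t, by simpa using hα s₂ hs2, ?_, ?_, ?_⟩
  · refine absolutelyContinuousOnInterval_of_dist_le
      (absolutelyContinuousOnInterval_integral hli s₂ s₁ s₂) 1 fun x hx t ht => ?_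
    rw [uIcc_of_le h12] at hx ht
    rw [hα x hx, hα t ht, dist_add_left, one_mul]
  · have hne : ∀ x : ℝ, ∀ᵐ t : ℝ, t ≠ x := fun x => by simp [ae_iff, measure_singleton]
    filter_upwards [_root_.LocallyIntegrable.ae_hasDerivAt_integral hli, hne s₁, hne s₂] with t ht h1 h2 hts
    refine ((ht s₂).const_add z).congr_of_eventuallyEq ?_
    filter_upwards [Icc_mem_nhds (lt_of_le_of_ne hts.1 h1.symm) (lt_of_le_of_ne hts.2 h2)]
      with x hx using hα x hx
  -- extended by constants, both solutions become continuous curves with values in the ball; at a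
  -- time `t₀` of maximal distance the integral equations bound it by `‖z - y s₂‖` and half of itself
  · let β : ℝ → E := fun t => y (projIcc s₁ s₂ h12 t)
    have hyc : ContinuousOn y (Icc s₁ s₂) := by simpa [uIcc_of_le h12] using hy.continuousOn
    have hβ : Continuous β := hyc.domRestrict.comp continuous_projIcc
    have hβK : ∀ t, β t ∈ Metric.closedBall y₀ r := fun t => hyK _ (projIcc s₁ s₂ h12 t).2
    have hyβ : EqOn y β (Icc s₁ s₂) := fun t ht => by simp [β, projIcc_of_mem h12 ht]
    let α' : ℝ → E := fun t => α (projIcc s₁ s₂ h12 t)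
    have hα'c : Continuous α' := hαc.comp (continuous_subtype_val.comp continuous_projIcc)
    have hαα' : EqOn α α' (Icc s₁ s₂) := fun t ht => by simp [α', projIcc_of_mem h12 ht]
    have hcont : ContinuousOn (fun t => ‖α t - y t‖) (Icc s₁ s₂) :=
      (hαc.continuousOn.sub hyc).norm
    obtain ⟨t₀, ht₀, hmax⟩ := isCompact_Icc.exists_isMaxOn ⟨s₁, hs1⟩ hcont
    have hD : ∀ t, ‖α' t - β t‖ ≤ ‖α t₀ - y t₀‖ := fun t => hmax (projIcc s₁ s₂ h12 t).2
    have hint : ∫ s in s₂..t₀, f s (α s) = ∫ s in s₂..t₀, f s (α' s) := by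
      refine intervalIntegral.integral_congr fun s hs => ?_
      have : s ∈ Icc s₁ s₂ := by
        rw [uIcc_of_ge ht₀.2] at hs
        exact ⟨ht₀.1.trans hs.1, hs.2⟩
      simp only [hαα' this]
    have h1 : ‖α t₀ - y t₀‖ ≤ ‖z - y s₂‖ + 1 / 2 * ‖α t₀ - y t₀‖ := by
      have e : α t₀ - y t₀ = (z - y s₂) +
          ((∫ s in s₂..t₀, f s (α' s)) - ∫ s in s₂..t₀, f s (β s)) := by
        rw [hα t₀ ht₀, hf.eq_add_integral h12 hy hy' hβ hβK hyβ t₀ ht₀, hint]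
        abel
      conv_lhs => rw [e]
      exact (norm_add_le _ _).trans (by
        gcongr
        exact hf.norm_integral_sub_le hα'c (fun t => hαK _) hβ hβK hD ht₀ hm)
    have h2 : ‖α s₁ - y s₁‖ ≤ ‖α t₀ - y t₀‖ := hmax hs1
    linarith

end Caratheodory

/-! ### Trajectories and the positive orbit -/

section Trajectories

variable {n : ℕ} {M : Type*} [TopologicalSpace M] [ChartedSpace (EuclideanSpace ℝ (Fin n)) M]
  {U : Type*} {V : U → (x : M) → TangentSpace (𝓡 n) x} {A : Set (ℝ → U)} {q : M}

lemma ae_ne_real (x : ℝ) : ∀ᵐ t : ℝ, t ≠ x := by simp [ae_iff, measure_singleton]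

lemma ae_comp_add {p : ℝ → Prop} (h : ∀ᵐ t : ℝ, p t) (c : ℝ) : ∀ᵐ t : ℝ, p (t + c) :=
  (quasiMeasurePreserving_add_right volume c).ae h

lemma hasMFDerivAt_comp_add {X : (x : M) → TangentSpace (𝓡 n) x} {γ : ℝ → M} {c t : ℝ}
    (h : HasMFDerivAt 𝓘(ℝ, ℝ) (𝓡 n) γ (t + c) ((1 : ℝ →L[ℝ] ℝ).smulRight (X (γ (t + c))))) :
    HasMFDerivAt 𝓘(ℝ, ℝ) (𝓡 n) (fun s => γ (s + c)) t
      ((1 : ℝ →L[ℝ] ℝ).smulRight (X (γ (t + c)))) := by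
  rw [← ContinuousLinearMap.comp_id (ContinuousLinearMap.smulRight 1 (X (γ (t + c))))]
  refine HasMFDerivAt.comp (g := γ) (f := fun s => s + c) t h ?_
  exact ((hasFDerivAt_id t).add_const c).hasMFDerivAt

/-- Concatenation of trajectories. The controls switch at `t < T₁`, as in the definition of an
admissible class, and the curves at `t ≤ T₁`; at the single time `T₁` nothing is required. -/
theorem IsTrajectory.concat {u₁ u₂ : ℝ → U} {γ₁ γ₂ : ℝ → M} {T₁ T₂ : ℝ} (h₁0 : 0 ≤ T₁)
    (h₂0 : 0 ≤ T₂) (h₁ : IsTrajectory V u₁ γ₁ T₁) (h₂ : IsTrajectory V u₂ γ₂ T₂)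
    (h : γ₂ 0 = γ₁ T₁) :
    IsTrajectory V (fun t => if t < T₁ then u₁ t else u₂ (t + -T₁))
      (fun t => if t ≤ T₁ then γ₁ t else γ₂ (t + -T₁)) (T₁ + T₂) := by
  set γ : ℝ → M := fun t => if t ≤ T₁ then γ₁ t else γ₂ (t + -T₁) with hγ
  have hl : EqOn γ γ₁ (Iic T₁) := fun t ht => if_pos ht
  have hr : EqOn γ (fun t => γ₂ (t + -T₁)) (Ici T₁) := by
    intro t ht
    rcases (show T₁ ≤ t from ht).eq_or_lt with rfl | ht
    · simp [hγ, h]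
    · simp [hγ, not_le.2 ht]
  refine ⟨?_, ?_, ?_⟩
  · rw [← Icc_union_Icc_eq_Icc h₁0 (le_add_of_nonneg_right h₂0)]
    refine ContinuousOn.union_of_isClosed ?_ ?_ isClosed_Icc isClosed_Icc
    · exact h₁.continuousOn.congr (hl.mono fun t ht => ht.2)
    · refine ContinuousOn.congr ?_ (hr.mono fun t ht => ht.1)
      refine h₂.continuousOn.comp (by fun_prop) fun t ht => ?_
      exact ⟨by linarith [ht.1], by linarith [ht.2]⟩
  · intro x₀ a b ha hab hb hs
    have hcl : ∀ b', a ≤ b' → b' ≤ T₁ → b' ≤ b →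
        AbsolutelyContinuousOnInterval (fun t => extChartAt (𝓡 n) x₀ (γ t)) a b' := by
      intro b' hab' hb' hbb
      refine absolutelyContinuousOnInterval_of_dist_le
        (h₁.absolutelyContinuous x₀ a b' ha hab' hb' fun t ht => ?_) 1 fun x hx y hy => ?_
      · rw [← hl (ht.2.trans hb')]; exact hs t ⟨ht.1, ht.2.trans hbb⟩
      · rw [uIcc_of_le hab'] at hx hy
        rw [one_mul, hl (hx.2.trans hb'), hl (hy.2.trans hb')]
    have hcr : ∀ a', a ≤ a' → T₁ ≤ a' → a' ≤ b →
        AbsolutelyContinuousOnInterval (fun t => extChartAt (𝓡 n) x₀ (γ t)) a' b := by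
      intro a' ha' hT hab'
      have e := h₂.absolutelyContinuous x₀ (a' + -T₁) (b + -T₁) (by linarith) (by linarith)
        (by linarith) fun t ht => by
          have := hs (t + T₁) ⟨by linarith [ht.1], by linarith [ht.2]⟩
          rw [hr (show T₁ ≤ t + T₁ by linarith [ht.1])] at this
          simpa using this
      have e' := absolutelyContinuousOnInterval_comp_monotone (c := a') (d := b) e
        (φ := fun t => t + -T₁) (fun x y hxy => by simpa using hxy)
        (LipschitzWith.of_dist_le_mul fun x y => by simp) (fun t ht => by
          rw [uIcc_of_le hab'] at ht
          rw [uIcc_of_le (by linarith)]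
          exact ⟨by linarith [ht.1], by linarith [ht.2]⟩)
      refine absolutelyContinuousOnInterval_of_dist_le e' 1 fun x hx y hy => ?_
      rw [uIcc_of_le hab'] at hx hy
      rw [one_mul, hr (hT.trans hx.1), hr (hT.trans hy.1)]
    rcases le_total b T₁ with hbT | hbT
    · exact hcl b hab hbT le_rfl
    rcases le_total T₁ a with haT | haT
    · exact hcr a le_rfl haT hab
    exact absolutelyContinuousOnInterval_trans haT hbT (hcl T₁ haT le_rfl hbT)
      (hcr T₁ haT le_rfl hbT)
  · filter_upwards [h₁.hasMFDerivAt, ae_comp_add h₂.hasMFDerivAt (-T₁), ae_ne_real T₁]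
      with t ht₁ ht₂ hne ht
    rcases lt_or_gt_of_ne hne with hlt | hlt
    · have e : γ t = γ₁ t := hl hlt.le
      simp only [if_pos hlt]
      rw [e]
      exact (ht₁ ⟨ht.1, hlt.le⟩).congr_of_eventuallyEq
        (by filter_upwards [Iio_mem_nhds hlt] with s hs using hl (mem_Iic.2 (mem_Iio.1 hs).le))
    · have e : γ t = γ₂ (t + -T₁) := hr hlt.le
      simp only [if_neg (not_lt.2 hlt.le)]
      rw [e]
      exact (hasMFDerivAt_comp_add (ht₂ ⟨by linarith, by linarith [ht.2]⟩)).congr_of_eventuallyEq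
        (by filter_upwards [Ioi_mem_nhds hlt] with s hs using hr (mem_Ici.2 (mem_Ioi.1 hs).le))

theorem positiveOrbit_trans (hA : IsAdmissibleClass V A) {p p' : M}
    (h : p ∈ positiveOrbit V A q) (h' : p' ∈ positiveOrbit V A p) : p' ∈ positiveOrbit V A q := by
  obtain ⟨u₁, hu₁, γ₁, T₁, hT₁, h₁, h₁0, h₁T⟩ := h
  obtain ⟨u₂, hu₂, γ₂, T₂, hT₂, h₂, h₂0, h₂T⟩ := h'
  refine ⟨_, hA.switch_mem u₁ hu₁ _ (hA.shift_mem u₂ hu₂ (-T₁)) T₁, _, T₁ + T₂, add_nonneg hT₁ hT₂,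
    h₁.concat hT₁ hT₂ h₂ (h₂0.trans h₁T.symm), by simp [hT₁, h₁0], ?_⟩
  rcases hT₂.eq_or_lt with rfl | hT
  · simp [h₁T, ← h₂0, ← h₂T]
  · simp [hT, h₂T]

variable [IsManifold (𝓡 n) ∞ M]

/-- A solution in one chart is a trajectory: absolute continuity in the other charts follows, as
the changes of coordinates are Lipschitz on compact sets. -/
theorem isTrajectory_of_chart {u : ℝ → U} {x₁ : M} {α : ℝ → EuclideanSpace ℝ (Fin n)} {T : ℝ}
    (hT : 0 ≤ T) (hα : AbsolutelyContinuousOnInterval α 0 T)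
    (hαt : ∀ t ∈ Icc 0 T, α t ∈ (extChartAt (𝓡 n) x₁).target)
    (hα' : ∀ᵐ t : ℝ, t ∈ Icc 0 T → HasDerivAt α (coordField (V (u t)) x₁ (α t)) t) :
    IsTrajectory V u (fun t => (extChartAt (𝓡 n) x₁).symm (α t)) T := by
  refine ⟨?_, ?_, ?_⟩
  · refine (continuousOn_extChartAt_symm x₁).comp ?_ hαt
    simpa [uIcc_of_le hT] using hα.continuousOn
  · intro x₀ a b ha hab hb hs
    have hsub : Icc a b ⊆ Icc 0 T := Icc_subset_Icc ha hb
    have hopen : IsOpen ((extChartAt (𝓡 n) x₁).symm ≫ extChartAt (𝓡 n) x₀).source := by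
      rw [PartialEquiv.trans_source]
      exact (continuousOn_extChartAt_symm x₁).isOpen_inter_preimage
        (isOpen_extChartAt_target x₁) (isOpen_extChartAt_source x₀)
    refine absolutelyContinuousOnInterval_comp_contDiffOn hopen
      ((contDiffOn_ext_coord_change (I := 𝓡 n) (n := ∞) x₀ x₁).of_le (by norm_cast))
      (hα.mono ?_) fun t ht => ?_
    · rwa [uIcc_of_le hab, uIcc_of_le hT]
    · rw [uIcc_of_le hab] at ht
      rw [PartialEquiv.trans_source]
      exact ⟨hαt t (hsub ht), hs t ht⟩
  · filter_upwards [hα'] with t ht hts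
    exact hasMFDerivAt_extChartAt_symm (hαt t hts) (ht hts)

variable [T2Space M]

theorem isTrajectory_flow (hV : ∀ a, IsSmoothField (V a)) (hc : ∀ a, IsCompleteField (V a)) (a : U)
    (p : M) (T : ℝ) : IsTrajectory V (fun _ => a) (fun t => flow (V a) t p) T := by
  refine ⟨(isMIntegralCurve_flow (hc a) p).continuous.continuousOn, ?_, ?_⟩
  · intro x₀ b c hb hbc hcT hs
    refine ContDiffOn.absolutelyContinuousOnInterval fun t ht => ?_
    rw [uIcc_of_le hbc] at ht
    have h1 : ContMDiffAt 𝓘(ℝ, ℝ) (𝓡 n) 2 (fun t => flow (V a) t p) t :=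
      ((contMDiff_flow (hV a) (hc a)).comp (contMDiff_id.prodMk contMDiff_const)).contMDiffAt
    exact ((contDiffAt_extChartAt_comp h1 (hs t ht)).of_le (by norm_num)).contDiffWithinAt
  · exact Eventually.of_forall fun t _ => isMIntegralCurve_flow (hc a) p t

theorem flow_mem_positiveOrbit (hV : ∀ a, IsSmoothField (V a)) (hc : ∀ a, IsCompleteField (V a))
    (hA : IsAdmissibleClass V A) (a : U) {t : ℝ} (ht : 0 ≤ t) (p : M) :
    flow (V a) t p ∈ positiveOrbit V A p :=
  ⟨_, hA.const_mem a, _, t, ht, isTrajectory_flow hV hc a p t, flow_zero (hc a) p, rfl⟩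

theorem chronProduct_mem_positiveOrbit (hV : ∀ a, IsSmoothField (V a))
    (hc : ∀ a, IsCompleteField (V a)) (hA : IsAdmissibleClass V A) [Nonempty U] {ι : Type*}
    (g : ι → U) (w : List ι) (t : Fin w.length → ℝ) (ht : ∀ i, 0 ≤ t i) (q : M) :
    chronProduct (fun i => V (g i)) w t q ∈ positiveOrbit V A q := by
  induction w with
  | nil =>
    have h := flow_mem_positiveOrbit hV hc hA (Classical.arbitrary U) le_rfl q
    rwa [flow_zero (hc _)] at h
  | cons a w ih =>
    exact positiveOrbit_trans hA (ih (Fin.tail t) fun i => ht i.succ)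
      (flow_mem_positiveOrbit hV hc hA (g a) (ht 0) _)

theorem generalPoints_subset_positiveOrbit (hV : ∀ a, IsSmoothField (V a))
    (hc : ∀ a, IsCompleteField (V a)) (hA : IsAdmissibleClass V A) [Nonempty U] {ι : Type*}
    (g : ι → U) (B : Finset (List ι)) (q : M) :
    generalPoints (fun i => V (g i)) B q ⊆ positiveOrbit V A q := by
  rintro _ ⟨w, _, t, ht, _, rfl⟩
  exact chronProduct_mem_positiveOrbit hV hc hA g w t (fun i => (ht i).le) q

end Trajectories

/-! ### Propagation of interior points along a trajectory -/

section Propagation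

variable {n : ℕ} {M : Type*} [TopologicalSpace M] [ChartedSpace (EuclideanSpace ℝ (Fin n)) M]
  [IsManifold (𝓡 n) ∞ M]
  {U : Type*} {V : U → (x : M) → TangentSpace (𝓡 n) x} {A : Set (ℝ → U)} {q : M}

theorem exists_isCaratheodory_coordField (hV : ∀ a, IsSmoothField (V a)) {u : ℝ → U}
    (hu : IsLocallyIntegrableField (fun t => V (u t))) {x₀ : M} {y₀ : EuclideanSpace ℝ (Fin n)}
    {r : ℝ} (hr : Metric.closedBall y₀ r ⊆ (extChartAt (𝓡 n) x₀).target) :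
    ∃ m : ℝ → ℝ, IsCaratheodory (fun t => coordField (V (u t)) x₀) m (Metric.closedBall y₀ r) := by
  obtain ⟨m, hm, hmK⟩ := (hu x₀).2 _ hr (isCompact_closedBall y₀ r)
  refine ⟨m, fun y hy => (hu x₀).1 y (hr hy), hm, hmK.mono fun t ht =>
    ⟨fun y hy => (ht y hy).1, fun y hy z hz => ?_⟩⟩
  refine (convex_closedBall y₀ r).norm_image_sub_le_of_norm_fderiv_le
    (fun x hx => ?_) (fun x hx => (ht x hx).2) hz hy
  exact (((contDiffOn_coordField (hV (u t)) x₀).contDiffAt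
    ((isOpen_extChartAt_target x₀).mem_nhds (hr hx))).differentiableAt (by simp))

/-- A point reached from `p` at the end of a solution in a chart belongs to the positive orbit of
`p`. -/
theorem mem_positiveOrbit_of_chart (hA : IsAdmissibleClass V A) {u : ℝ → U} (hu : u ∈ A) {x₀ : M}
    {α : ℝ → EuclideanSpace ℝ (Fin n)} {s₁ s₂ : ℝ} (h12 : s₁ ≤ s₂)
    (hα : AbsolutelyContinuousOnInterval α s₁ s₂)
    (hαt : ∀ t ∈ Icc s₁ s₂, α t ∈ (extChartAt (𝓡 n) x₀).target)
    (hα' : ∀ᵐ t : ℝ, t ∈ Icc s₁ s₂ → HasDerivAt α (coordField (V (u t)) x₀ (α t)) t) :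
    (extChartAt (𝓡 n) x₀).symm (α s₂) ∈
      positiveOrbit V A ((extChartAt (𝓡 n) x₀).symm (α s₁)) := by
  have hmaps : MapsTo (fun t => t + s₁) (Icc 0 (s₂ - s₁)) (Icc s₁ s₂) := fun t ht =>
    ⟨by linarith [ht.1], by linarith [ht.2]⟩
  have htr : IsTrajectory V (fun t => u (t + s₁))
      (fun t => (extChartAt (𝓡 n) x₀).symm (α (t + s₁))) (s₂ - s₁) := by
    refine isTrajectory_of_chart (sub_nonneg.2 h12) ?_ (fun t ht => hαt _ (hmaps ht)) ?_
    · refine absolutelyContinuousOnInterval_comp_monotone hα (fun x y hxy => by simpa using hxy)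
        (LipschitzWith.of_dist_le_mul fun x y => by simp) ?_
      rwa [uIcc_of_le h12, uIcc_of_le (sub_nonneg.2 h12)]
    · filter_upwards [ae_comp_add hα' s₁] with t ht hts
      exact (ht (hmaps hts)).comp_add_const t s₁
  exact ⟨_, hA.shift_mem u hu s₁, _, s₂ - s₁, sub_nonneg.2 h12, htr, by simp, by simp⟩

/-- Near each time, a trajectory carries interior points of the positive orbit to interior points:
the equation can be solved backward from all points near the later one, which ends up near the
earlier one. -/
theorem IsTrajectory.exists_forall_mem_interior (hV : ∀ a, IsSmoothField (V a))
    (hA : IsAdmissibleClass V A) {u : ℝ → U} (hu : u ∈ A) {γ : ℝ → M} {T : ℝ}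
    (hγ : IsTrajectory V u γ T) {s₀ : ℝ} (hs₀ : s₀ ∈ Icc 0 T) :
    ∃ δ > 0, ∀ s₁ ∈ Icc 0 T, ∀ s₂ ∈ Icc 0 T, dist s₁ s₀ < δ → dist s₂ s₀ < δ → s₁ ≤ s₂ →
      γ s₁ ∈ interior (positiveOrbit V A q) → γ s₂ ∈ interior (positiveOrbit V A q) := by
  let φ := extChartAt (𝓡 n) (γ s₀)
  let y₀ := φ (γ s₀)
  have hy₀ : y₀ ∈ φ.target := mem_extChartAt_target (I := 𝓡 n) (γ s₀)
  obtain ⟨r, hr, hrt⟩ := Metric.nhds_basis_closedBall.mem_iff.1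
    ((isOpen_extChartAt_target (I := 𝓡 n) (γ s₀)).mem_nhds hy₀)
  obtain ⟨m, hm⟩ := exists_isCaratheodory_coordField hV (hA.locallyIntegrable u hu) hrt
  have hFc : Continuous (fun t => ∫ s in (0 : ℝ)..t, m s) :=
    intervalIntegral.continuous_primitive
      (fun a b => hm.locallyIntegrable.intervalIntegrable a b) 0
  have hr4 : 0 < r / 4 := by positivity
  have hcont : ContinuousWithinAt (fun s => φ (γ s)) (Icc 0 T) s₀ :=
    (continuousAt_extChartAt (I := 𝓡 n) (γ s₀)).comp_continuousWithinAt (hγ.continuousOn s₀ hs₀)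
  have hη : 0 < min (1 / 4) (r / 4) := by positivity
  have hev : ∀ᶠ s in 𝓝[Icc 0 T] s₀, γ s ∈ φ.source ∧ φ (γ s) ∈ Metric.ball y₀ (r / 4) ∧
      (∫ x in (0 : ℝ)..s, m x) ∈ Metric.ball (∫ x in (0 : ℝ)..s₀, m x) (min (1 / 4) (r / 4)) :=
    ((hγ.continuousOn s₀ hs₀).eventually_mem (extChartAt_source_mem_nhds (I := 𝓡 n) (γ s₀))).and
      ((hcont.eventually_mem (Metric.ball_mem_nhds _ hr4)).and
        (hFc.continuousWithinAt.eventually_mem (Metric.ball_mem_nhds _ hη)))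
  obtain ⟨δ, hδ, hδs⟩ := Metric.mem_nhdsWithin_iff.1 hev
  refine ⟨δ, hδ, fun s₁ hs₁ s₂ hs₂ h1 h2 h12 hint => ?_⟩
  have hsub : ∀ t ∈ Icc s₁ s₂, t ∈ Metric.ball s₀ δ ∩ Icc 0 T := fun t ht =>
    ⟨(convex_ball s₀ δ).ordConnected.out h1 h2 ht, hs₁.1.trans ht.1, ht.2.trans hs₂.2⟩
  have hsrc : ∀ t ∈ Icc s₁ s₂, γ t ∈ φ.source := fun t ht => (hδs (hsub t ht)).1
  have hball : ∀ t ∈ Icc s₁ s₂, φ (γ t) ∈ Metric.ball y₀ (r / 4) := fun t ht =>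
    (hδs (hsub t ht)).2.1
  have hs1 : s₁ ∈ Icc s₁ s₂ := left_mem_Icc.2 h12
  have hs2 : s₂ ∈ Icc s₁ s₂ := right_mem_Icc.2 h12
  have hm12 : ∫ s in s₁..s₂, m s ≤ 2 * min (1 / 4) (r / 4) := by
    have e1 := (hδs (hsub s₁ hs1)).2.2
    have e2 := (hδs (hsub s₂ hs2)).2.2
    rw [Metric.mem_ball, Real.dist_eq] at e1 e2
    rw [← intervalIntegral.integral_interval_sub_left
      (hm.locallyIntegrable.intervalIntegrable 0 s₂) (hm.locallyIntegrable.intervalIntegrable 0 s₁)]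
    linarith [(abs_lt.1 e1).1, (abs_lt.1 e2).2]
  -- points of the chart near `φ (γ s₁)` lie in the interior of the orbit
  have hψ : ∀ᶠ y in 𝓝 (φ (γ s₁)), φ.symm y ∈ interior (positiveOrbit V A q) := by
    have hc : ContinuousAt φ.symm (φ (γ s₁)) :=
      continuousAt_extChartAt_symm' (I := 𝓡 n) (hsrc s₁ hs1)
    refine hc.eventually_mem (isOpen_interior.mem_nhds ?_)
    rwa [φ.left_inv (hsrc s₁ hs1)]
  obtain ⟨ε, hε, hεs⟩ := Metric.eventually_nhds_iff.1 hψ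
  have hnear : ∀ᶠ p in 𝓝 (γ s₂), p ∈ φ.source ∧
      φ p ∈ Metric.ball (φ (γ s₂)) (min (ε / 2) (r / 4)) := by
    have hc : ContinuousAt φ (γ s₂) := continuousAt_extChartAt' (I := 𝓡 n) (hsrc s₂ hs2)
    exact ((isOpen_extChartAt_source (I := 𝓡 n) (γ s₀)).eventually_mem (hsrc s₂ hs2)).and
      (hc.eventually_mem (Metric.ball_mem_nhds _ (by positivity)))
  rw [mem_interior_iff_mem_nhds]
  filter_upwards [hnear] with p hp
  have hp2 := hp.2
  rw [mem_ball_iff_norm, lt_min_iff] at hp2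
  have hz : ‖φ p - y₀‖ ≤ r / 2 := by
    have e := hball s₂ hs2
    rw [mem_ball_iff_norm] at e
    linarith [norm_sub_le_norm_sub_add_norm_sub (φ p) (φ (γ s₂)) y₀]
  have hac : AbsolutelyContinuousOnInterval (fun t => φ (γ t)) s₁ s₂ :=
    hγ.absolutelyContinuous (γ s₀) s₁ s₂ hs₁.1 h12 hs₂.2 hsrc
  obtain ⟨α, hαK, hαz, hαac, hα', hαs⟩ := hm.exists_solution_near h12
    (hm12.trans (by linarith [min_le_left (1 / 4) (r / 4)]))
    (hm12.trans (by linarith [min_le_right (1 / 4) (r / 4)])) hz hac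
    (by
      filter_upwards [hγ.hasMFDerivAt] with t ht hts
      exact hasDerivAt_extChartAt (hsrc t hts) (ht (hsub t hts).2))
    (fun t ht => Metric.ball_subset_closedBall
      (Metric.ball_subset_ball (by linarith) (hball t ht)))
  have hmem := mem_positiveOrbit_of_chart hA hu h12 hαac (fun t ht => hrt (hαK t ht)) hα'
  rw [hαz, φ.left_inv hp.1] at hmem
  refine positiveOrbit_trans hA (interior_subset (hεs ?_)) hmem
  rw [dist_eq_norm]
  exact hαs.trans_lt (by linarith [hp2.1])

/-- Along a trajectory, interior points of the positive orbit are followed by interior points. -/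
theorem IsTrajectory.mem_interior_of_le (hV : ∀ a, IsSmoothField (V a))
    (hA : IsAdmissibleClass V A) {u : ℝ → U} (hu : u ∈ A) {γ : ℝ → M} {T : ℝ}
    (hγ : IsTrajectory V u γ T) {a : ℝ} (ha : a ∈ Icc 0 T)
    (hint : γ a ∈ interior (positiveOrbit V A q)) :
    ∀ s ∈ Icc a T, γ s ∈ interior (positiveOrbit V A q) := by
  have hloc : ∀ s₀ : Icc a T, ∃ δ > 0, ∀ s₁ ∈ Icc 0 T, ∀ s₂ ∈ Icc 0 T, dist s₁ s₀ < δ →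
      dist s₂ s₀ < δ → s₁ ≤ s₂ →
      γ s₁ ∈ interior (positiveOrbit V A q) → γ s₂ ∈ interior (positiveOrbit V A q) := fun s₀ =>
    hγ.exists_forall_mem_interior hV hA hu ⟨ha.1.trans s₀.2.1, s₀.2.2⟩
  choose δ hδ hprop using hloc
  obtain ⟨t, ht0, htm, ⟨N, hN⟩, hcov⟩ := exists_monotone_Icc_subset_open_cover_Icc ha.2
    (c := fun s₀ : Icc a T => Metric.ball s₀ (δ s₀)) (fun _ => Metric.isOpen_ball)
    (fun s _ => mem_iUnion.2 ⟨s, Metric.mem_ball_self (hδ s)⟩)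
  have hmain : ∀ k, ∀ s : Icc a T, s ≤ t k → γ s ∈ interior (positiveOrbit V A q) := by
    intro k
    induction k with
    | zero =>
      intro s hs
      have hsa : (s : ℝ) ≤ t 0 := hs
      rw [ht0] at hsa
      have : (s : ℝ) = a := le_antisymm hsa s.2.1
      rwa [this]
    | succ k ih =>
      intro s hs
      rcases le_total s (t k) with h | h
      · exact ih s h
      obtain ⟨s₀, hs₀⟩ := hcov k
      have hsub : ∀ x : Icc a T, (x : ℝ) ∈ Icc 0 T := fun x => ⟨ha.1.trans x.2.1, x.2.2⟩
      exact hprop s₀ (t k) (hsub _) s (hsub _) (hs₀ ⟨le_rfl, h.trans hs⟩) (hs₀ ⟨h, hs⟩) h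
        (ih (t k) le_rfl)
  intro s hs
  refine hmain N ⟨s, hs⟩ ?_
  change s ≤ (t N : ℝ)
  rw [hN N le_rfl]
  exact hs.2

end Propagation

end ControlSystem

theorem theorem1 {n : ℕ} {M : Type*} [TopologicalSpace M] [T2Space M] [SecondCountableTopology M]
    [ChartedSpace (EuclideanSpace ℝ (Fin n)) M] [IsManifold (𝓡 n) ∞ M]
    {U : Type*} (V : U → (x : M) → TangentSpace (𝓡 n) x)
    (hsmooth : ∀ u, ControlSystem.IsSmoothField (V u))
    (hcomplete : ∀ u, ControlSystem.IsCompleteField (V u))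
    (A : Set (ℝ → U)) (hA : ControlSystem.IsAdmissibleClass V A)
    (q : M) {d : ℕ} (g : Fin d → U) (B : Finset (List (Fin d)))
    (hLARC : ControlSystem.IsGeneratingAt (fun i => V (g i)) B q) :
    (∀ w : List (Fin d), ControlSystem.IsGeneralWord B w →
      IsOpen (ControlSystem.regularPoints (fun i => V (g i)) w q)) ∧
    IsOpen (ControlSystem.generalPoints (fun i => V (g i)) B q) ∧
    (ControlSystem.generalPoints (fun i => V (g i)) B q).Nonempty ∧
    ∀ u ∈ A, ∀ (γ : ℝ → M) (T : ℝ), ControlSystem.IsTrajectory V u γ T →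
      γ 0 = q → γ T = q →
      ControlSystem.IsGeneralCurve (fun i => V (g i)) B q γ T →
      ∃ O : Set M, IsOpen O ∧ γ '' Icc 0 T ⊆ O ∧ O ⊆ ControlSystem.positiveOrbit V A q := by
  have hW : ∀ i, ControlSystem.IsSmoothField (V (g i)) := fun i => hsmooth (g i)
  have hc : ∀ i, ControlSystem.IsCompleteField (V (g i)) := fun i => hcomplete (g i)
  have hopen := ControlSystem.isOpen_generalPoints hW hc B q
  refine ⟨fun w _ => ControlSystem.isOpen_regularPoints hW hc q w, hopen,
    hLARC.generalPoints_nonempty hW hc, ?_⟩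
  rintro u hu γ T hγ h0 hT ⟨-, ε, hε, hεT, hgen⟩
  have : Nonempty U := ⟨u 0⟩
  have hsub := ControlSystem.generalPoints_subset_positiveOrbit hsmooth hcomplete hA g B q
  have hT0 : 0 ≤ T := hε.le.trans hεT
  have hq : γ 0 ∈ interior (ControlSystem.positiveOrbit V A q) := by
    have h := hγ.mem_interior_of_le hsmooth hA hu ⟨hε.le, hεT⟩ (interior_maximal hsub hopen hgen) T
      ⟨hεT, le_rfl⟩
    rw [hT] at h
    rwa [h0]
  refine ⟨interior (ControlSystem.positiveOrbit V A q), isOpen_interior, ?_, interior_subset⟩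
  rintro _ ⟨s, hs, rfl⟩
  exact hγ.mem_interior_of_le hsmooth hA hu ⟨le_rfl, hT0⟩ hq s hs
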